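/- Let $F \subseteq K$ be a field extension, let $n \ge 1$, let $R = K[x_1,\dots,x_n]$ and let $d_1,\dots,d_n$ be nonnegative integers. Let $J = (f_1,\dots,f_n) \subset R$ be a generic ideal of type $(n,d_1,\dots,d_n)$ over $F$: each $f_i$ is a form of degree $d_i$, and the coefficients of $f_1,\dots,f_n$ at all monomials of the respective degrees $d_1,\dots,d_n$ are, taken together, algebraically independent over $F$. Put $A = R/J$, with degree $j$ component $A_j$, and $\delta = d_1 + \cdots + d_n - n$. Fix the graded reverse lexicographic order with $x_1 > \cdots > x_n$, let $\mathrm{in}(J)$ be the ideal generated by the leading terms of all elements of $J$, and let $B_j$ be the set of monomials of degree $j$ that do not lie in $\mathrm{in}(J)$. Let $0 \le j \le \delta$ and $r \ge 0$. Then the multiplication map $x_n^r : A_j \to A_{j+r}$ is injective or surjective. More precisely: (i) If $|B_j| \le |B_{j+r}|$, then $x_n^r B_j$ is exactly the set of the $|B_j|$ smallest monomials of $B_{j+r}$. (ii) If $|B_j| \ge |B_{j+r}|$, then $B_{j+r} = x_n^r S$, where $S$ is the set of the $|B_{j+r}|$ smallest monomials of $B_j$. Moreover, $x_n$ is a strong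 Lefschetz element for $A$: $A$ is finite-dimensional over $K$, and for all $i, d \ge 0$ the map $x_n^d : A_i \to A_{i+d}$ is injective if $\dim_K A_i \le \dim_K A_{i+d}$ and surjective if $\dim_K A_i \ge \dim_K A_{i+d}$. -/

import Mathlib

open scoped MonomialOrder

namespace GenericIdeal

/-! ### The graded reverse lexicographic order -/

/-- Exponent vectors in `n` variables, to be ordered by the graded reverse lexicographic order. -/
def GRevLex (n : ℕ) : Type := Fin n →₀ ℕ

noncomputable instance (n : ℕ) : AddCommMonoid (GRevLex n) :=
  inferInstanceAs (AddCommMonoid (Fin n →₀ ℕ))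

/-- The vector of partial sums `(α₀ + ⋯ + αₙ₋₁, α₀ + ⋯ + αₙ₋₂, …, α₀)` of an exponent vector.
Comparing these vectors lexicographically is comparing first the degrees and then, in equal
degree, looking at the last exponent that differs (see `grevlex_lt_iff`). -/
def partialSums (n : ℕ) (a : GRevLex n) : Lex (Fin n → ℕ) :=
  toLex fun k => ∑ i ∈ Finset.univ.filter (fun i : Fin n => i ≤ k.rev), (show Fin n →₀ ℕ from a) i

theorem partialSums_add (n : ℕ) (a b : GRevLex n) :
    partialSums n (a + b) = partialSums n a + partialSums n b := by
  have h : ∀ i, (show Fin n →₀ ℕ from a + b) i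
      = (show Fin n →₀ ℕ from a) i + (show Fin n →₀ ℕ from b) i := fun i =>
    Finsupp.add_apply (show Fin n →₀ ℕ from a) (show Fin n →₀ ℕ from b) i
  refine ofLex.injective (funext fun k => ?_)
  simp only [partialSums, ofLex_toLex, ofLex_add, Pi.add_apply, h, Finset.sum_add_distrib]

/-- If all partial sums from position `i` on agree, then so do all exponents after `i`. -/
theorem eq_of_sums_eq {n : ℕ} {a b : Fin n →₀ ℕ} {i : Fin n}
    (h : ∀ j, i ≤ j → ∑ l ∈ Finset.univ.filter (fun l : Fin n => l ≤ j), a l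
      = ∑ l ∈ Finset.univ.filter (fun l : Fin n => l ≤ j), b l) :
    ∀ j, i < j → a j = b j := by
  intro j hij
  obtain ⟨j', hj'⟩ : ∃ j' : Fin n, (j' : ℕ) + 1 = j := by
    have : (i : ℕ) < j := hij
    exact ⟨⟨j - 1, by omega⟩, by simp; omega⟩
  have hs : Finset.univ.filter (fun l : Fin n => l ≤ j)
      = insert j (Finset.univ.filter (fun l : Fin n => l ≤ j')) := by
    ext l
    simp only [Finset.mem_filter, Finset.mem_univ, true_and, Finset.mem_insert, Fin.le_def,
      Fin.ext_iff]
    omega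
  have hn : j ∉ Finset.univ.filter (fun l : Fin n => l ≤ j') := by
    simp only [Finset.mem_filter, Finset.mem_univ, true_and, Fin.le_def]
    omega
  have h1 := h j hij.le
  have h2 := h j' (by have : (i : ℕ) < j := hij; rw [Fin.le_def]; omega)
  rw [hs, Finset.sum_insert hn, Finset.sum_insert hn, h2] at h1
  exact Nat.add_right_cancel h1

theorem partialSums_injective (n : ℕ) : Function.Injective (partialSums n) := by
  intro a b hab
  have h : ∀ j : Fin n, ∑ l ∈ Finset.univ.filter (fun l : Fin n => l ≤ j), (show Fin n →₀ ℕ from a) l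
      = ∑ l ∈ Finset.univ.filter (fun l : Fin n => l ≤ j), (show Fin n →₀ ℕ from b) l := by
    intro j
    have := congrFun (congrArg ofLex hab) j.rev
    simpa [partialSums] using this
  refine Finsupp.ext (f := (show Fin n →₀ ℕ from a)) (g := (show Fin n →₀ ℕ from b)) fun j => ?_
  by_cases hj : (j : ℕ) = 0
  · have hs : Finset.univ.filter (fun l : Fin n => l ≤ j) = {j} := by
      ext l
      simp only [Finset.mem_filter, Finset.mem_univ, true_and, Finset.mem_singleton, Fin.le_def,
        Fin.ext_iff]
      omega
    have := h j
    rwa [hs, Finset.sum_singleton, Finset.sum_singleton] at this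
  · exact eq_of_sums_eq (i := ⟨0, by omega⟩) (fun j _ => h j) j (by rw [Fin.lt_def]; simp; omega)

noncomputable instance (n : ℕ) : LinearOrder (GRevLex n) :=
  LinearOrder.lift' (partialSums n) (partialSums_injective n)

theorem GRevLex.le_iff {n : ℕ} {a b : GRevLex n} : a ≤ b ↔ partialSums n a ≤ partialSums n b :=
  Iff.rfl

theorem GRevLex.lt_iff {n : ℕ} {a b : GRevLex n} : a < b ↔ partialSums n a < partialSums n b :=
  Iff.rfl

/-- The graded reverse lexicographic order on monomials in `x₀ > x₁ > ⋯ > xₙ₋₁`. -/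
noncomputable def grevlex (n : ℕ) : MonomialOrder (Fin n) where
  syn := GRevLex n
  isOrderedAddMonoid_syn :=
    { add_le_add_left := fun a b h c => by
        rw [GRevLex.le_iff] at h ⊢
        rw [partialSums_add, partialSums_add]
        exact add_le_add_left h _ }
  toSyn :=
    { toFun := fun a => a
      invFun := fun a => a
      left_inv := fun _ => rfl
      right_inv := fun _ => rfl
      map_add' := fun _ _ => rfl }
  toSyn_monotone := fun a b h => by
    change partialSums n a ≤ partialSums n b
    refine Pi.toLex_monotone fun k => ?_
    exact Finset.sum_le_sum fun i _ => h i
  wellFoundedLT_syn := ⟨(InvImage.wf (partialSums n) wellFounded_lt)⟩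

theorem sum_le_add_sum_lt {n : ℕ} (a : Fin n →₀ ℕ) (j : Fin n) :
    ∑ l ∈ Finset.univ.filter (fun l : Fin n => l ≤ j), a l
      + ∑ l ∈ Finset.univ.filter (fun l : Fin n => j < l), a l = a.degree := by
  rw [Finsupp.degree_eq_sum, ← Finset.sum_filter_add_sum_filter_not Finset.univ (fun l => l ≤ j)]
  simp only [not_le]

/-- The usual description: `x^a < x^b` iff `deg x^a < deg x^b`, or the degrees are equal and, at the
last place where they differ, the exponent of `x^a` is the larger one. -/
theorem grevlex_lt_iff {n : ℕ} {a b : Fin n →₀ ℕ} :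
    a ≺[grevlex n] b ↔ a.degree < b.degree ∨
      (a.degree = b.degree ∧ ∃ i, b i < a i ∧ ∀ j, i < j → a j = b j) := by
  have key : a ≺[grevlex n] b ↔ ∃ i : Fin n,
      (∀ j, i < j → ∑ l ∈ Finset.univ.filter (fun l : Fin n => l ≤ j), a l
        = ∑ l ∈ Finset.univ.filter (fun l : Fin n => l ≤ j), b l) ∧
      ∑ l ∈ Finset.univ.filter (fun l : Fin n => l ≤ i), a l
        < ∑ l ∈ Finset.univ.filter (fun l : Fin n => l ≤ i), b l := by
    have hc : a ≺[grevlex n] b ↔ ∃ k : Fin n,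
        (∀ j, j < k → ∑ l ∈ Finset.univ.filter (fun l : Fin n => l ≤ j.rev), a l
          = ∑ l ∈ Finset.univ.filter (fun l : Fin n => l ≤ j.rev), b l) ∧
        ∑ l ∈ Finset.univ.filter (fun l : Fin n => l ≤ k.rev), a l
          < ∑ l ∈ Finset.univ.filter (fun l : Fin n => l ≤ k.rev), b l := Iff.rfl
    rw [hc]
    constructor
    · rintro ⟨k, h1, h2⟩
      refine ⟨k.rev, fun j hj => ?_, h2⟩
      have := h1 j.rev (by rwa [← Fin.rev_lt_rev, Fin.rev_rev])
      simpa using this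
    · rintro ⟨i, h1, h2⟩
      refine ⟨i.rev, fun j hj => h1 j.rev (by rwa [← Fin.rev_lt_rev, Fin.rev_rev]), ?_⟩
      simpa using h2
  rw [key]
  constructor
  · rintro ⟨i, h1, h2⟩
    have ha := sum_le_add_sum_lt a
    have hb := sum_le_add_sum_lt b
    by_cases hi : (i : ℕ) + 1 = n
    · left
      have he : Finset.univ.filter (fun l : Fin n => i < l) = ∅ := by
        ext l
        simp only [Finset.mem_filter, Finset.mem_univ, true_and, Fin.lt_def, Finset.notMem_empty,
          iff_false]
        omega
      have h3 := ha i
      have h4 := hb i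
      rw [he, Finset.sum_empty] at h3 h4
      omega
    · right
      obtain ⟨i', hi'⟩ : ∃ i' : Fin n, (i' : ℕ) = i + 1 := ⟨⟨i + 1, by omega⟩, rfl⟩
      have hii : i < i' := by rw [Fin.lt_def]; omega
      have htail : ∀ j, i' < j → a j = b j :=
        eq_of_sums_eq fun j hj => h1 j (lt_of_lt_of_le hii hj)
      have hs : Finset.univ.filter (fun l : Fin n => l ≤ i')
          = insert i' (Finset.univ.filter (fun l : Fin n => l ≤ i)) := by
        ext l
        simp only [Finset.mem_filter, Finset.mem_univ, true_and, Finset.mem_insert, Fin.le_def,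
          Fin.ext_iff]
        omega
      have hn : i' ∉ Finset.univ.filter (fun l : Fin n => l ≤ i) := by
        simp only [Finset.mem_filter, Finset.mem_univ, true_and, Fin.le_def]
        omega
      have h3 := h1 i' hii
      refine ⟨?_, i', ?_, htail⟩
      · rw [← ha i', ← hb i', h3]
        congr 1
        exact Finset.sum_congr rfl fun l hl => htail l (Finset.mem_filter.1 hl).2
      · rw [hs, Finset.sum_insert hn, Finset.sum_insert hn] at h3
        omega
  · have ha := sum_le_add_sum_lt a
    have hb := sum_le_add_sum_lt b
    rintro (h | ⟨h, i, h1, h2⟩)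
    · have hn : n ≠ 0 := by
        rintro rfl
        simp [Finsupp.degree_eq_sum] at h
      have hle : ∀ c : Fin n →₀ ℕ, ∑ l ∈ Finset.univ.filter
          (fun l : Fin n => l ≤ ⟨n - 1, by omega⟩), c l = c.degree := by
        intro c
        rw [Finsupp.degree_eq_sum, Finset.filter_true_of_mem]
        intro l _
        rw [Fin.le_def]
        simp only
        omega
      refine ⟨⟨n - 1, by omega⟩, fun j hj => ?_, ?_⟩
      · rw [Fin.lt_def] at hj
        simp only at hj
        omega
      · rw [hle, hle]
        exact h
    · have htail : ∀ j, i ≤ j → ∑ l ∈ Finset.univ.filter (fun l : Fin n => j < l), a l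
          = ∑ l ∈ Finset.univ.filter (fun l : Fin n => j < l), b l := fun j hj =>
        Finset.sum_congr rfl fun l hl => h2 l (lt_of_le_of_lt hj (Finset.mem_filter.1 hl).2)
      have hpre : ∀ j, i ≤ j → ∑ l ∈ Finset.univ.filter (fun l : Fin n => l ≤ j), a l
          = ∑ l ∈ Finset.univ.filter (fun l : Fin n => l ≤ j), b l := by
        intro j hj
        have h3 := ha j
        have h4 := hb j
        have h5 := htail j hj
        omega
      have hi := hpre i le_rfl
      by_cases h0 : (i : ℕ) = 0
      · have hs : Finset.univ.filter (fun l : Fin n => l ≤ i) = {i} := by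
          ext l
          simp only [Finset.mem_filter, Finset.mem_univ, true_and, Finset.mem_singleton,
            Fin.le_def, Fin.ext_iff]
          omega
        rw [hs, Finset.sum_singleton, Finset.sum_singleton] at hi
        omega
      · obtain ⟨i', hi'⟩ : ∃ i' : Fin n, (i' : ℕ) + 1 = i :=
          ⟨⟨i - 1, by omega⟩, by simp only; omega⟩
        have hs : Finset.univ.filter (fun l : Fin n => l ≤ i)
            = insert i (Finset.univ.filter (fun l : Fin n => l ≤ i')) := by
          ext l
          simp only [Finset.mem_filter, Finset.mem_univ, true_and, Finset.mem_insert, Fin.le_def,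
            Fin.ext_iff]
          omega
        have hn : i ∉ Finset.univ.filter (fun l : Fin n => l ≤ i') := by
          simp only [Finset.mem_filter, Finset.mem_univ, true_and, Fin.le_def]
          omega
        rw [hs, Finset.sum_insert hn, Finset.sum_insert hn] at hi
        refine ⟨i', fun j hj => hpre j ?_, by omega⟩
        rw [Fin.lt_def] at hj
        rw [Fin.le_def]
        omega

/-! ### Initial ideals and standard monomials -/

section

variable {K : Type*} [Field K] {n : ℕ}

/-- The initial ideal `in(J)` with respect to the graded reverse lexicographic order: the ideal
generated by the leading terms of all elements of `J`. -/
noncomputable def initialIdeal (J : Ideal (MvPolynomial (Fin n) K)) :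
    Ideal (MvPolynomial (Fin n) K) :=
  Ideal.span ((grevlex n).leadingTerm '' (J : Set (MvPolynomial (Fin n) K)))

/-- The (exponent vectors of the) standard monomials of degree `j` with respect to `J`, that is,
`B_j`: the monomials `x^α` of degree `j` that do not lie in `in(J)`. -/
def standardMonomials (J : Ideal (MvPolynomial (Fin n) K)) (j : ℕ) : Set (Fin n →₀ ℕ) :=
  {a | a.degree = j ∧ MvPolynomial.monomial a (1 : K) ∉ initialIdeal J}

/-- `S` is the set of the `k` smallest monomials of `T` in the graded reverse lexicographic order:
`S` is a subset of `T` with exactly `k` elements, and each of them is smaller than each monomial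
of `T` outside `S`. -/
def IsSmallest (k : ℕ) (T S : Set (Fin n →₀ ℕ)) : Prop :=
  S ⊆ T ∧ S.Finite ∧ S.ncard = k ∧ ∀ a ∈ S, ∀ b ∈ T \ S, a ≺[grevlex n] b

/-- The set `x_i^r S = {x_i^r m | m ∈ S}`, on exponent vectors. -/
def varPowMul (i : Fin n) (r : ℕ) (S : Set (Fin n →₀ ℕ)) : Set (Fin n →₀ ℕ) :=
  (fun a => Finsupp.single i r + a) '' S

/-! ### The graded quotient and Lefschetz elements -/

/-- The component `A_j` of degree `j` of `A = R/J` for a homogeneous ideal `J`. -/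
noncomputable def gradedPiece (J : Ideal (MvPolynomial (Fin n) K)) (j : ℕ) :
    Submodule K (MvPolynomial (Fin n) K ⧸ J) :=
  (MvPolynomial.homogeneousSubmodule (Fin n) K j).map (Ideal.Quotient.mkₐ K J).toLinearMap

/-- Multiplication by the class of a form `L` of degree `r` maps `A_j` to `A_{j+r}`. -/
theorem mul_mem_gradedPiece (J : Ideal (MvPolynomial (Fin n) K)) {L : MvPolynomial (Fin n) K}
    {r : ℕ} (hL : L.IsHomogeneous r) (j : ℕ) :
    ∀ a ∈ gradedPiece J j,
      LinearMap.mulLeft K (Ideal.Quotient.mk J L) a ∈ gradedPiece J (j + r) := by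
  rintro _ ⟨p, hp, rfl⟩
  refine ⟨L * p, ?_, ?_⟩
  · have h : (L * p).IsHomogeneous (r + j) :=
      hL.mul ((MvPolynomial.mem_homogeneousSubmodule j p).1 hp)
    rw [add_comm] at h
    exact (MvPolynomial.mem_homogeneousSubmodule _ _).2 h
  · simp

/-- The multiplication map `A_j → A_{j+r}` by a form `L` of degree `r`. -/
noncomputable def mulMap (J : Ideal (MvPolynomial (Fin n) K)) {L : MvPolynomial (Fin n) K}
    {r : ℕ} (hL : L.IsHomogeneous r) (j : ℕ) :
    gradedPiece J j →ₗ[K] gradedPiece J (j + r) :=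
  (LinearMap.mulLeft K (Ideal.Quotient.mk J L)).restrict (mul_mem_gradedPiece J hL j)

theorem isHomogeneous_linear_pow {L : MvPolynomial (Fin n) K} (hL : L.IsHomogeneous 1) (r : ℕ) :
    (L ^ r).IsHomogeneous r := by
  simpa using hL.pow r

/-- The linear form `L` is a strong Lefschetz element for `A = R/J`: the ring `A` is
finite-dimensional over `K`, and for all `i` and `d` the multiplication map
`L^d : A_i → A_{i+d}` has maximal rank. -/
def IsStrongLefschetzElement (J : Ideal (MvPolynomial (Fin n) K)) (L : MvPolynomial (Fin n) K) :
    Prop :=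
  Module.Finite K (MvPolynomial (Fin n) K ⧸ J) ∧
  ∃ hL : L.IsHomogeneous 1, ∀ i d : ℕ,
    (Module.finrank K (gradedPiece J i) ≤ Module.finrank K (gradedPiece J (i + d)) →
      Function.Injective (mulMap J (isHomogeneous_linear_pow hL d) i)) ∧
    (Module.finrank K (gradedPiece J (i + d)) ≤ Module.finrank K (gradedPiece J i) →
      Function.Surjective (mulMap J (isHomogeneous_linear_pow hL d) i))

end

/-! ### Generic ideals -/

/-- `J ⊆ K[x₀, …, xₙ₋₁]` is a generic ideal of type `(n, d₀, …, d_{s-1})` over the subfield `F`: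
it is generated by forms `f₀, …, f_{s-1}` of degrees `d₀, …, d_{s-1}` such that the coefficients of
the `f i` at all monomials of degree `d i`, for all `i` together, are algebraically independent
over `F`. -/
def IsGenericIdeal (F : Type*) {K : Type*} [Field F] [Field K] [Algebra F K] {n s : ℕ}
    (d : Fin s → ℕ) (J : Ideal (MvPolynomial (Fin n) K)) : Prop :=
  ∃ f : Fin s → MvPolynomial (Fin n) K,
    (∀ i, (f i).IsHomogeneous (d i)) ∧
    AlgebraicIndependent F
      (fun p : (i : Fin s) × {a : Fin n →₀ ℕ // a.degree = d i} => (f p.1).coeff p.2.1) ∧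
    J = Ideal.span (Set.range f)

end GenericIdeal

namespace GenericIdeal

open MvPolynomial

/-! ### Specialization: spanning modulo forms with algebraically independent coefficients -/

section Specialization

variable {K : Type*} [Field K] {n s : ℕ}

/-! Write δ for the sum of the `d i - 1`, and suppose all `d i` are positive. Everything rests on
one fact: `x_n^(δ-2j) : A_j → A_{δ-j}` is onto whenever `2j ≤ δ`. This says that monomials divisible
by `x_n^(δ-2j)` span degree `δ - j` modulo `J`, a condition expressed by a nonvanishing minor whose
entries are 0, 1 or coefficients of the forms. A minor that is nonzero for some forms of the same
degrees is a nonzero polynomial over `F`, hence nonzero at algebraically independent coefficients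
(`monomial_mem_of_specialization`). It therefore suffices to exhibit one good system of forms.

For the basis of `A` the good system is `x_i^(d i)`: the monomials with exponents below `d i` span.
Spanning by this box already forces a basis (`isCompl_box`), so the Hilbert function of `A` is
symmetric about `δ/2`.

For the Lefschetz property the good system is a chain `x_0^(d 0), g_1(x_0, x_1), g_2(x_1, x_2), …`
of general binary forms. Adding one variable at a time, the quotient stays spanned by strings `w, w
x_k, w x_k^2, …` centered at half the current socle degree, as in a Clebsch–Gordan decomposition
(`exists_annihilated_form`, `monomial_mem_stringSpan`). With the symmetric Hilbert function the
central maps are bijective, and every power of `x_n` is a factor of one of them or maps to zero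
(`lefschetz_of_central`).

The statements on `B_j` use the reverse lexicographic order: in a fixed degree, a larger exponent of
`x_n` makes a monomial smaller. Hence a form whose leading monomial is divisible by `x_n^r` is
itself divisible by `x_n^r`. Injectivity then sends standard monomials to standard monomials, and
surjectivity makes all standard monomials of the target divisible by `x_n^r`; both sets of smallest
monomials are cut out by the last exponent. -/

theorem monomial_eq_smul (γ : Fin n →₀ ℕ) (a : K) : monomial γ a = a • monomial γ (1 : K) := by
  simp [smul_monomial]

/-- The degree `m` part of the ideal generated by forms `f i` of degrees `d i`. -/
noncomputable def macaulay (f : Fin s → MvPolynomial (Fin n) K) (d : Fin s → ℕ) (m : ℕ) :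
    Submodule K (MvPolynomial (Fin n) K) :=
  Submodule.span K {p | ∃ i, ∃ γ : Fin n →₀ ℕ, γ.degree + d i = m ∧ p = monomial γ 1 * f i}

theorem macaulay_le_span (f : Fin s → MvPolynomial (Fin n) K) (d : Fin s → ℕ) (m : ℕ) :
    macaulay f d m ≤ (Ideal.span (Set.range f)).restrictScalars K := by
  refine Submodule.span_le.2 ?_
  rintro _ ⟨i, γ, -, rfl⟩
  exact Ideal.mul_mem_left _ _ (Ideal.subset_span ⟨i, rfl⟩)

/-- After expanding the multipliers into monomials every summand is homogeneous, so taking a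
component keeps or kills it. This turns ideal membership in one degree into linear algebra. -/
theorem homogeneousComponent_mem_macaulay {f : Fin s → MvPolynomial (Fin n) K} {d : Fin s → ℕ}
    (hf : ∀ i, (f i).IsHomogeneous (d i)) (m : ℕ) {u : MvPolynomial (Fin n) K}
    (hu : u ∈ Ideal.span (Set.range f)) : homogeneousComponent m u ∈ macaulay f d m := by
  classical
  rw [Ideal.span, Submodule.mem_span_range_iff_exists_fun] at hu
  obtain ⟨c, rfl⟩ := hu
  rw [map_sum]
  refine Submodule.sum_mem _ fun i _ => ?_
  rw [smul_eq_mul, (c i).as_sum, Finset.sum_mul, map_sum]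
  refine Submodule.sum_mem _ fun γ _ => ?_
  have h := (isHomogeneous_monomial (R := K) (d := γ) (coeff γ (c i)) rfl).mul (hf i)
  rw [homogeneousComponent_of_mem h]
  split_ifs with hm
  · rw [monomial_eq_smul, smul_mul_assoc]
    exact Submodule.smul_mem _ _ (Submodule.subset_span ⟨i, γ, hm.symm, rfl⟩)
  · exact zero_mem _

theorem homogeneousComponent_mem_span {f : Fin s → MvPolynomial (Fin n) K} {d : Fin s → ℕ}
    (hf : ∀ i, (f i).IsHomogeneous (d i)) (m : ℕ) {u : MvPolynomial (Fin n) K}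
    (hu : u ∈ Ideal.span (Set.range f)) :
    homogeneousComponent m u ∈ Ideal.span (Set.range f) :=
  macaulay_le_span f d m (homogeneousComponent_mem_macaulay hf m hu)

/-- A spanning family of vectors contains a basis, detected by a nonvanishing minor. -/
theorem exists_det_ne_zero_of_span_eq_top {ι κ : Type*} [Fintype ι] [DecidableEq ι]
    (v : κ → ι → K) (hv : Submodule.span K (Set.range v) = ⊤) :
    ∃ ρ : ι → κ, (Matrix.of fun a => v (ρ a)).det ≠ 0 := by
  obtain ⟨τ, a, -, hspan, hli⟩ := exists_linearIndependent' K v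
  let b := Module.Basis.mk hli (by rw [hspan, hv])
  let e := b.indexEquiv (Pi.basisFun K ι)
  refine ⟨fun i => a (e.symm i), ?_⟩
  have h2 : LinearIndependent K (fun i => v (a (e.symm i))) := hli.comp _ e.symm.injective
  have h3 := Matrix.linearIndependent_rows_iff_isUnit.1
    (show LinearIndependent K (Matrix.of fun i => v (a (e.symm i))).row from h2)
  exact ((Matrix.isUnit_iff_isUnit_det _).1 h3).ne_zero

theorem span_eq_top_of_det_ne_zero {ι κ : Type*} [Fintype ι] [DecidableEq ι]
    (v : κ → ι → K) (ρ : ι → κ) (h : (Matrix.of fun a => v (ρ a)).det ≠ 0) :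
    Submodule.span K (Set.range v) = ⊤ := by
  have h2 := Matrix.linearIndependent_rows_iff_isUnit.2
    ((Matrix.isUnit_iff_isUnit_det _).2 (isUnit_iff_ne_zero.2 h))
  have h3 := h2.span_eq_top_of_card_eq_finrank' (by simp)
  refine top_le_iff.1 (h3 ▸ Submodule.span_mono ?_)
  rintro _ ⟨i, rfl⟩
  exact ⟨ρ i, rfl⟩

/-- The generators of the degree `m` part of `⟨x^β | β ∈ T⟩ + (f)` -/
noncomputable def macaulayGen (f : Fin s → MvPolynomial (Fin n) K) (d : Fin s → ℕ) (m : ℕ)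
    (T : Set (Fin n →₀ ℕ)) :
    ({β : T // β.1.degree = m} ⊕ {p : Fin s × (Fin n →₀ ℕ) // p.2.degree + d p.1 = m}) →
      MvPolynomial (Fin n) K
  | .inl β => monomial β.1.1 1
  | .inr p => monomial p.1.2 1 * f p.1.1

theorem isHomogeneous_macaulayGen {f : Fin s → MvPolynomial (Fin n) K} {d : Fin s → ℕ}
    (hf : ∀ i, (f i).IsHomogeneous (d i)) (m : ℕ) (T : Set (Fin n →₀ ℕ)) (k) :
    (macaulayGen f d m T k).IsHomogeneous m := by
  match k with
  | .inl β => exact isHomogeneous_monomial _ β.2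
  | .inr p =>
    have := (isHomogeneous_monomial (R := K) (d := p.1.2) 1 rfl).mul (hf p.1.1)
    rwa [p.2] at this

/-- The coefficient vectors of the generators, as polynomials in the coefficients of the forms. -/
noncomputable def macaulayEntry (F : Type*) [Field F] (d : Fin s → ℕ) (m : ℕ)
    (T : Set (Fin n →₀ ℕ)) (α : {α : Fin n →₀ ℕ // α.degree = m}) :
    ({β : T // β.1.degree = m} ⊕ {p : Fin s × (Fin n →₀ ℕ) // p.2.degree + d p.1 = m}) →
      MvPolynomial ((i : Fin s) × {a : Fin n →₀ ℕ // a.degree = d i}) F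
  | .inl β => open Classical in if β.1.1 = α.1 then 1 else 0
  | .inr p => open Classical in
      if h : p.1.2 ≤ α.1 then X ⟨p.1.1, α.1 - p.1.2, by
        have h1 := congrArg Finsupp.degree (tsub_add_cancel_of_le h)
        have h2 := p.2
        have h3 := α.2
        rw [map_add] at h1
        omega⟩ else 0

/-- Each entry is 0, 1 or a single variable, so one matrix over a polynomial ring over `F`
specializes to the coefficient matrix of every system of forms. -/
theorem aeval_macaulayEntry {F : Type*} [Field F] [Algebra F K]
    (f : Fin s → MvPolynomial (Fin n) K) (d : Fin s → ℕ) (m : ℕ) (T : Set (Fin n →₀ ℕ))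
    (α : {α : Fin n →₀ ℕ // α.degree = m}) (k) :
    aeval (fun p : (i : Fin s) × {a : Fin n →₀ ℕ // a.degree = d i} => (f p.1).coeff p.2.1)
      (macaulayEntry F d m T α k) = (macaulayGen f d m T k).coeff α.1 := by
  classical
  match k with
  | .inl β =>
    simp only [macaulayEntry, macaulayGen, coeff_monomial]
    split_ifs <;> simp
  | .inr p =>
    simp only [macaulayEntry, macaulayGen, coeff_monomial_mul']
    split_ifs <;> simp

theorem monomial_mem_span_macaulayGen {f : Fin s → MvPolynomial (Fin n) K} {d : Fin s → ℕ}
    (hf : ∀ i, (f i).IsHomogeneous (d i)) (m : ℕ) (T : Set (Fin n →₀ ℕ)) (α : Fin n →₀ ℕ)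
    (hα : α.degree = m)
    (h : monomial α (1 : K) ∈ Submodule.span K ((fun β => monomial β (1 : K)) '' T) ⊔
      (Ideal.span (Set.range f)).restrictScalars K) :
    monomial α (1 : K) ∈ Submodule.span K (Set.range (macaulayGen f d m T)) := by
  classical
  obtain ⟨u, hu, v, hv, huv⟩ := Submodule.mem_sup.1 h
  have h1 : homogeneousComponent m (monomial α (1 : K)) = monomial α 1 :=
    homogeneousComponent_eq_self (isHomogeneous_monomial _ hα)
  rw [← h1, ← huv, map_add]
  refine add_mem ?_ ?_
  · clear huv
    induction hu using Submodule.span_induction with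
    | mem x hx =>
      obtain ⟨β, hβ, rfl⟩ := hx
      simp only
      rw [homogeneousComponent_of_mem (isHomogeneous_monomial (R := K) (d := β) 1 rfl)]
      split_ifs with hm
      · exact Submodule.subset_span ⟨.inl ⟨⟨β, hβ⟩, hm.symm⟩, rfl⟩
      · exact zero_mem _
    | zero => simp
    | add x y _ _ hx hy => rw [map_add]; exact add_mem hx hy
    | smul a x _ hx => rw [map_smul]; exact Submodule.smul_mem _ _ hx
  · refine Submodule.span_le.2 ?_ (homogeneousComponent_mem_macaulay hf m hv)
    rintro _ ⟨i, γ, hγ, rfl⟩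
    exact Submodule.subset_span ⟨.inr ⟨(i, γ), hγ⟩, rfl⟩

theorem span_macaulayGen_le (f : Fin s → MvPolynomial (Fin n) K) (d : Fin s → ℕ)
    (m : ℕ) (T : Set (Fin n →₀ ℕ)) :
    Submodule.span K (Set.range (macaulayGen f d m T)) ≤
      Submodule.span K ((fun β => monomial β (1 : K)) '' T) ⊔
        (Ideal.span (Set.range f)).restrictScalars K := by
  refine Submodule.span_le.2 ?_
  rintro _ ⟨k, rfl⟩
  match k with
  | .inl β => exact Submodule.mem_sup_left (Submodule.subset_span ⟨β.1.1, β.1.2, rfl⟩)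
  | .inr p =>
    exact Submodule.mem_sup_right (Ideal.mul_mem_left _ _ (Ideal.subset_span ⟨p.1.1, rfl⟩))

/-- If the coefficients of the forms `f` are algebraically independent, then the monomials in `T`
span modulo `(f)` in degree `m` as soon as they do so for some forms of the same degrees. -/
theorem monomial_mem_of_specialization {F : Type*} [Field F] [Algebra F K] {d : Fin s → ℕ}
    {f g : Fin s → MvPolynomial (Fin n) K} (hf : ∀ i, (f i).IsHomogeneous (d i))
    (hg : ∀ i, (g i).IsHomogeneous (d i))
    (hind : AlgebraicIndependent F
      (fun p : (i : Fin s) × {a : Fin n →₀ ℕ // a.degree = d i} => (f p.1).coeff p.2.1))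
    (m : ℕ) (T : Set (Fin n →₀ ℕ))
    (h : ∀ α : Fin n →₀ ℕ, α.degree = m →
      monomial α (1 : K) ∈ Submodule.span K ((fun β => monomial β (1 : K)) '' T) ⊔
        (Ideal.span (Set.range g)).restrictScalars K) (α : Fin n →₀ ℕ) (hα : α.degree = m) :
    monomial α (1 : K) ∈ Submodule.span K ((fun β => monomial β (1 : K)) '' T) ⊔
      (Ideal.span (Set.range f)).restrictScalars K := by
  classical
  have : Fintype {α : Fin n →₀ ℕ // α.degree = m} :=
    (Finsupp.finite_of_degree_eq (σ := Fin n) m).fintype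
  let ι := {α : Fin n →₀ ℕ // α.degree = m}
  let coeffs : MvPolynomial (Fin n) K →ₗ[K] (ι → K) := LinearMap.pi fun α => lcoeff K α.1
  have hcoeffs : ∀ p α, coeffs p α = p.coeff α.1 := fun p α => rfl
  have hsingle : ∀ α : ι, coeffs (monomial α.1 1) = Pi.single α 1 := by
    intro α
    ext β
    rw [hcoeffs, coeff_monomial, Pi.single_apply]
    by_cases hαβ : α = β
    · simp [hαβ]
    · rw [if_neg fun h => hαβ (Subtype.ext h), if_neg fun h => hαβ h.symm]
  -- The spanning hypothesis for `g` becomes full rank of a coefficient matrix; a nonzero maximal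
  -- minor selects the generators `ρ`.
  have hspan : Submodule.span K (Set.range fun k => coeffs (macaulayGen g d m T k)) = ⊤ := by
    refine top_le_iff.1 ?_
    rw [← (Pi.basisFun K ι).span_eq]
    refine Submodule.span_le.2 ?_
    rintro _ ⟨α, rfl⟩
    rw [Pi.basisFun_apply, ← hsingle]
    have := Submodule.mem_map_of_mem (f := coeffs)
      (monomial_mem_span_macaulayGen hg m T α.1 α.2 (h α.1 α.2))
    rwa [Submodule.map_span, ← Set.range_comp] at this
  obtain ⟨ρ, hρ⟩ := exists_det_ne_zero_of_span_eq_top _ hspan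
  -- The minor picked out by `ρ`, with indeterminate coefficients. It is nonzero because its value
  -- at `g` is, and algebraic independence carries this to `f`.
  let D : MvPolynomial ((i : Fin s) × {a : Fin n →₀ ℕ // a.degree = d i}) F :=
    (Matrix.of fun a b => macaulayEntry F d m T b (ρ a)).det
  have hD : ∀ f' : Fin s → MvPolynomial (Fin n) K,
      aeval (fun p : (i : Fin s) × {a : Fin n →₀ ℕ // a.degree = d i} => (f' p.1).coeff p.2.1) D
        = (Matrix.of fun a => coeffs (macaulayGen f' d m T (ρ a))).det := by
    intro f'
    rw [AlgHom.map_det]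
    congr 1
    ext a b
    exact aeval_macaulayEntry f' d m T b (ρ a)
  have hD0 : D ≠ 0 := by
    intro h0
    apply hρ
    rw [← hD, h0, map_zero]
  have hdet : (Matrix.of fun a => coeffs (macaulayGen f d m T (ρ a))).det ≠ 0 := by
    rw [← hD]
    intro h0
    exact hD0 ((injective_iff_map_eq_zero _).1 hind _ h0)
  have htop := span_eq_top_of_det_ne_zero (fun k => coeffs (macaulayGen f d m T k)) ρ hdet
  refine span_macaulayGen_le f d m T ?_
  -- Recovers a form of degree `m` from its coefficient vector, to carry the full span back to
  -- polynomials.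
  let Ψ : (ι → K) →ₗ[K] MvPolynomial (Fin n) K :=
    Fintype.linearCombination K (fun α : ι => monomial α.1 (1 : K))
  have hΨ : ∀ k, Ψ (coeffs (macaulayGen f d m T k)) = macaulayGen f d m T k := by
    intro k
    ext β
    simp only [Ψ, Fintype.linearCombination_apply, coeff_sum, hcoeffs, coeff_smul,
      coeff_monomial, smul_eq_mul, mul_ite, mul_one, mul_zero]
    by_cases hβ : β.degree = m
    · rw [Finset.sum_eq_single (⟨β, hβ⟩ : ι)]
      · simp
      · intro b _ hb
        rw [if_neg fun h => hb (Subtype.ext h)]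
      · simp
    · rw [(isHomogeneous_macaulayGen hf m T k).coeff_eq_zero hβ]
      refine Finset.sum_eq_zero fun b _ => ?_
      rw [if_neg]
      rintro rfl
      exact hβ b.2
  have hmem : (Pi.single (⟨α, hα⟩ : ι) (1 : K) : ι → K) ∈
      Submodule.span K (Set.range fun k => coeffs (macaulayGen f d m T k)) := by
    rw [htop]
    trivial
  have := Submodule.mem_map_of_mem (f := Ψ) hmem
  rw [Submodule.map_span, ← Set.range_comp] at this
  simp only [Function.comp_def, hΨ] at this
  simpa [Ψ, Fintype.linearCombination_apply_single] using this

/-- A field containing algebraically independent coefficients of forms is infinite. -/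
theorem infinite_of_algebraicIndependent {F : Type*} [Field F] [Algebra F K] {ι : Type*}
    [Nonempty ι] {c : ι → K} (hc : AlgebraicIndependent F c) : Infinite K :=
  (hc.transcendental (Classical.arbitrary ι)).infinite

end Specialization

/-! ### Nonsingular Toeplitz matrices -/

section Toeplitz

/-- The Toeplitz matrix `(c (i + a - b))`, where `c` is extended by zero to negative indices. -/
def toeplitz {A : Type*} [Zero A] (c : ℕ → A) (i N : ℕ) : Matrix (Fin N) (Fin N) A :=
  Matrix.of fun a b => if (b : ℕ) ≤ i + a then c (i + a - b) else 0

/-- Over an infinite field there are forms in two variables all of whose relevant Toeplitz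
matrices are invertible. -/
theorem exists_toeplitz_det_ne_zero (K : Type*) [Field K] [Infinite K] (d B : ℕ) :
    ∃ c : ℕ → K, (∀ k, d < k → c k = 0) ∧ c d ≠ 0 ∧
      ∀ i < d, ∀ N ≤ B, (toeplitz c i N).det ≠ 0 := by
  let Y : ℕ → MvPolynomial ℕ K := fun k => if k ≤ d then X k else 0
  let P : MvPolynomial ℕ K := X d *
    ∏ i ∈ Finset.range d, ∏ N ∈ Finset.range (B + 1), (toeplitz Y i N).det
  have heval : ∀ (v : ℕ → K) (i N : ℕ), eval v (toeplitz Y i N).det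
      = (toeplitz (fun k => if k ≤ d then v k else 0) i N).det := by
    intro v i N
    rw [RingHom.map_det]
    congr 1
    ext a b
    simp only [toeplitz, Y, RingHom.mapMatrix_apply, Matrix.map_apply, Matrix.of_apply]
    split_ifs <;> simp
  have hP : P ≠ 0 := by
    refine mul_ne_zero (X_ne_zero d) (Finset.prod_ne_zero_iff.2 fun i hi =>
      Finset.prod_ne_zero_iff.2 fun N _ h0 => ?_)
    -- For the sequence with a single 1 at index `i` the Toeplitz matrix is the identity, so its
    -- generic determinant is not the zero polynomial.
    have h1 := heval (Pi.single i 1) i N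
    have h2 : toeplitz (fun k => if k ≤ d then (Pi.single i 1 : ℕ → K) k else 0) i N = 1 := by
      ext a b
      have := Finset.mem_range.1 hi
      simp only [toeplitz, Matrix.of_apply, Matrix.one_apply, Pi.single_apply, Fin.ext_iff]
      split_ifs <;> first | rfl | omega
    rw [h0, h2, map_zero, Matrix.det_one] at h1
    exact zero_ne_one h1
  obtain ⟨v, hv⟩ : ∃ v, eval v P ≠ 0 := by
    by_contra! h
    exact hP (MvPolynomial.funext fun v => by rw [h, map_zero])
  simp only [P, map_mul, map_prod, eval_X, heval] at hv
  have hv2 := right_ne_zero_of_mul hv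
  refine ⟨fun k => if k ≤ d then v k else 0, fun k hk => if_neg (by omega), ?_, ?_⟩
  · simpa using left_ne_zero_of_mul hv
  · intro i hi N hN
    exact Finset.prod_ne_zero_iff.1 (Finset.prod_ne_zero_iff.1 hv2 i (Finset.mem_range.2 hi)) N
      (Finset.mem_range.2 (by omega))

end Toeplitz

/-! ### Strings in two variables -/

section TwoVariables

variable {K R : Type*} [Field K] [CommRing R] [Algebra K R]

/-- The form `∑ c_t x^t y^(d-t)` in two elements of an algebra. -/
def binaryForm (c : ℕ → K) (d : ℕ) (x y : R) : R :=
  ∑ t ∈ Finset.range (d + 1), c t • (x ^ t * y ^ (d - t))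

/-- Reindexing by the shift `a`, with `c` extended by zero as in the Toeplitz matrix, gives all
shifts a common range of summation. -/
theorem sum_smul_shift (c : ℕ → K) {d a E : ℕ} (hc : ∀ k, d < k → c k = 0) (hE : a + d ≤ E)
    (φ : ℕ → R) :
    ∑ t ∈ Finset.range (d + 1), c t • φ (t + a)
      = ∑ b ∈ Finset.range (E + 1), (if a ≤ b then c (b - a) else 0) • φ b := by
  have h1 : ∑ t ∈ Finset.range (d + 1), c t • φ (t + a)
      = ∑ b ∈ Finset.Ico a (a + (d + 1)), (if a ≤ b then c (b - a) else 0) • φ b := by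
    rw [Finset.sum_Ico_eq_sum_range, Nat.add_sub_cancel_left]
    refine Finset.sum_congr rfl fun t _ => ?_
    rw [if_pos (by omega), Nat.add_sub_cancel_left, add_comm]
  rw [h1]
  refine Finset.sum_subset (fun b hb => ?_) fun b _ hb => ?_
  · rw [Finset.mem_Ico] at hb
    exact Finset.mem_range.2 (by omega)
  · rw [Finset.mem_Ico] at hb
    split_ifs with hab
    · rw [hc _ (by omega), zero_smul]
    · rw [zero_smul]

/-- Modulo `x^s` and a binary form with invertible Toeplitz matrices, there is a form of degree `i`
in `x` and `y`, monic in `x`, which is annihilated by `y^(s+d-1-2i)`. -/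
theorem exists_annihilated_form {c : ℕ → K} {d s i : ℕ} (hc : ∀ k, d < k → c k = 0)
    (hdet : (toeplitz c i (s - i)).det ≠ 0) (his : i < s) (hid : i < d) {x y : R} {I : Ideal R}
    (hx : x ^ s ∈ I) (hg : binaryForm c d x y ∈ I) :
    ∃ q : ℕ → K, y ^ (s + d - 1 - 2 * i) *
      (x ^ i + ∑ b ∈ Finset.range i, q b • (x ^ b * y ^ (i - b))) ∈ I := by
  obtain ⟨N, rfl⟩ : ∃ N, s = i + (N + 1) := ⟨s - i - 1, by omega⟩
  rw [Nat.add_sub_cancel_left] at hdet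
  -- The rows are the coefficients of `x^i, …, x^(s-1)` in the product of the binary form with `∑
  -- h_a x^a y^(N-a)`. Solving for the first unit vector leaves 1 at `x^i` and 0 at the others,
  -- while higher powers of `x` die modulo `x^s`.
  obtain ⟨h, hh⟩ : ∃ h, (toeplitz c i (N + 1)).mulVec h = Pi.single 0 1 :=
    ⟨(toeplitz c i (N + 1))⁻¹.mulVec (Pi.single 0 1), by
      rw [Matrix.mulVec_mulVec, Matrix.mul_nonsing_inv _ (isUnit_iff_ne_zero.2 hdet),
        Matrix.one_mulVec]⟩
  let E := d + N
  let q : ℕ → K := fun b => ∑ a : Fin (N + 1), (if (a : ℕ) ≤ b then c (b - a) else 0) * h a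
  have hq : ∀ ρ (hρ : ρ < N + 1), q (i + ρ) = if ρ = 0 then 1 else 0 := by
    intro ρ hρ
    have := congrFun hh ⟨ρ, hρ⟩
    simp only [Matrix.mulVec, dotProduct, toeplitz, Matrix.of_apply, Pi.single_apply,
      Fin.ext_iff, Fin.val_zero] at this
    exact this
  have hprod : binaryForm c d x y * ∑ a : Fin (N + 1), h a • (x ^ (a : ℕ) * y ^ (N - a))
      = ∑ b ∈ Finset.range (E + 1), q b • (x ^ b * y ^ (E - b)) := by
    simp only [q, Finset.sum_smul, mul_smul]
    rw [Finset.sum_comm, Finset.mul_sum]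
    refine Finset.sum_congr rfl fun a _ => ?_
    have ha := a.2
    have h1 := sum_smul_shift c (a := a) (E := E) hc (by omega)
      (fun b => h a • (x ^ b * y ^ (E - b)))
    rw [← h1, binaryForm, Finset.sum_mul]
    refine Finset.sum_congr rfl fun t ht => ?_
    have := Finset.mem_range.1 ht
    rw [smul_mul_smul_comm, mul_smul, show E - (t + a) = (d - t) + (N - a) by omega, pow_add,
      pow_add]
    congr 2
    ring
  have hmem : ∑ b ∈ Finset.range (E + 1), q b • (x ^ b * y ^ (E - b)) ∈ I :=
    hprod ▸ I.mul_mem_right _ hg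
  refine ⟨q, ?_⟩
  -- The product has degree `E = d + N` with `N = s - 1 - i`, so its terms up to `x^i` share the
  -- factor `y^(E-i)`, where `E - i = s + d - 1 - 2i`.
  have hsplit : ∑ b ∈ Finset.range (E + 1), q b • (x ^ b * y ^ (E - b))
      = y ^ (i + (N + 1) + d - 1 - 2 * i) *
        (x ^ i + ∑ b ∈ Finset.range i, q b • (x ^ b * y ^ (i - b)))
        + ∑ b ∈ Finset.Ico (i + 1) (E + 1), q b • (x ^ b * y ^ (E - b)) := by
    rw [← Finset.sum_range_add_sum_Ico _ (show i + 1 ≤ E + 1 by omega), Finset.sum_range_succ]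
    congr 1
    have h0 := hq 0 (by omega)
    rw [add_zero, if_pos rfl] at h0
    rw [h0, one_smul, mul_add, Finset.mul_sum, add_comm]
    congr 1
    · rw [mul_comm]
      congr 2
      omega
    · refine Finset.sum_congr rfl fun b hb => ?_
      have := Finset.mem_range.1 hb
      rw [mul_smul_comm, mul_left_comm, ← pow_add]
      congr 3
      omega
  rw [hsplit] at hmem
  refine (I.add_mem_iff_left (I.sum_mem fun b hb => ?_)).1 hmem
  rw [Finset.mem_Ico] at hb
  by_cases hb2 : b < i + (N + 1)
  · have h0 := hq (b - i) (by omega)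
    rw [if_neg (by omega), show i + (b - i) = b by omega] at h0
    rw [h0, zero_smul]
    exact I.zero_mem
  · rw [← Algebra.smul_mul_assoc, show b = (i + (N + 1)) + (b - (i + (N + 1))) by omega, pow_add]
    refine I.mul_mem_right _ ?_
    rw [Algebra.smul_def]
    exact I.mul_mem_left _ (I.mul_mem_right _ hx)

/-- The strings `y^b p_i` span `K[x, y]` modulo `x^s` and a general binary form. -/
theorem monomial_mem_of_strings {c : ℕ → K} {d s : ℕ} (hc : ∀ k, d < k → c k = 0) (hcd : c d ≠ 0)
    (hdet : ∀ i < d, (toeplitz c i (s - i)).det ≠ 0) {x y : R} {I : Ideal R}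
    (hx : x ^ s ∈ I) (hg : binaryForm c d x y ∈ I) (S : Submodule K R)
    (hIS : ∀ u ∈ I, u ∈ S)
    (hS : ∀ i, i < s → i < d → ∀ q : ℕ → K, y ^ (s + d - 1 - 2 * i) *
        (x ^ i + ∑ b ∈ Finset.range i, q b • (x ^ b * y ^ (i - b))) ∈ I →
      ∀ b, (x ^ i + ∑ b ∈ Finset.range i, q b • (x ^ b * y ^ (i - b))) * y ^ b ∈ S)
    (a b : ℕ) : x ^ a * y ^ b ∈ S := by
  induction a using Nat.strong_induction_on generalizing b with
  | _ a ih =>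
    by_cases has : a < s
    · by_cases had : a < d
      · obtain ⟨q, hq⟩ := exists_annihilated_form hc (hdet a had) has had hx hg
        have h1 := hS a has had q hq b
        rw [add_mul, Finset.sum_mul] at h1
        refine (S.add_mem_iff_left (S.sum_mem fun t ht => ?_)).1 h1
        rw [smul_mul_assoc, mul_assoc, ← pow_add]
        exact S.smul_mem _ (ih t (Finset.mem_range.1 ht) _)
      · have h1 := hIS _ (I.mul_mem_right (x ^ (a - d) * y ^ b) hg)
        rw [binaryForm, Finset.sum_range_succ, add_mul, Finset.sum_mul] at h1
        have h2 := (S.add_mem_iff_right (S.sum_mem fun t ht => ?_)).1 h1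
        · rw [smul_mul_assoc, Submodule.smul_mem_iff _ hcd, Nat.sub_self, pow_zero, mul_one,
            ← mul_assoc, ← pow_add, show d + (a - d) = a by omega] at h2
          exact h2
        · have ht := Finset.mem_range.1 ht
          rw [smul_mul_assoc, show x ^ t * y ^ (d - t) * (x ^ (a - d) * y ^ b)
            = x ^ (t + (a - d)) * y ^ (d - t + b) by ring]
          exact S.smul_mem _ (ih _ (by omega) _)
    · rw [show a = s + (a - s) by omega, pow_add, mul_assoc]
      exact hIS _ (I.mul_mem_right _ hx)

end TwoVariables

/-! ### The chain of binary forms and its centered strings -/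

section Chain

variable {K : Type*} [Field K] {n : ℕ}

theorem isHomogeneous_binaryForm (c : ℕ → K) (d : ℕ) (i j : Fin n) :
    (binaryForm c d (X i : MvPolynomial (Fin n) K) (X j)).IsHomogeneous d := by
  refine IsHomogeneous.sum _ _ _ fun t ht => ?_
  have := Finset.mem_range.1 ht
  have h := (isHomogeneous_X_pow (R := K) i t).mul (isHomogeneous_X_pow j (d - t))
  rw [show t + (d - t) = d by omega] at h
  rw [smul_eq_C_mul]
  exact h.C_mul _

/-- The forms `x₀^d₀, g₁(x₀, x₁), g₂(x₁, x₂), …` with binary forms `gᵢ` of degree `dᵢ`. -/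
noncomputable def chainForms (c : Fin n → ℕ → K) (d : Fin (n + 1) → ℕ) :
    Fin (n + 1) → MvPolynomial (Fin (n + 1)) K :=
  Fin.cases (X 0 ^ d 0) fun k => binaryForm (c k) (d k.succ) (X k.castSucc) (X k.succ)

theorem isHomogeneous_chainForms (c : Fin n → ℕ → K) (d : Fin (n + 1) → ℕ) (i : Fin (n + 1)) :
    (chainForms c d i).IsHomogeneous (d i) := by
  cases i using Fin.cases with
  | zero => exact isHomogeneous_X_pow 0 (d 0)
  | succ k => exact isHomogeneous_binaryForm _ _ _ _

/-- The socle degree of the complete intersection of the first `k + 1` forms. -/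
def partialSocle (d : Fin (n + 1) → ℕ) (k : Fin (n + 1)) : ℕ :=
  ∑ i ∈ Finset.Iic k, (d i - 1)

theorem partialSocle_zero (d : Fin (n + 1) → ℕ) : partialSocle d 0 = d 0 - 1 := by
  rw [partialSocle, show Finset.Iic (0 : Fin (n + 1)) = {0} by ext; simp, Finset.sum_singleton]

theorem partialSocle_succ (d : Fin (n + 1) → ℕ) (k : Fin n) :
    partialSocle d k.succ = partialSocle d k.castSucc + (d k.succ - 1) := by
  rw [partialSocle, partialSocle, show Finset.Iic k.succ = insert k.succ (Finset.Iic k.castSucc) by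
    ext i
    simp only [Finset.mem_Iic, Finset.mem_insert, Fin.le_def, Fin.ext_iff, Fin.val_succ,
      Fin.val_castSucc]
    omega, Finset.sum_insert (by simp [Fin.le_def]), add_comm]

theorem partialSocle_last (d : Fin (n + 1) → ℕ) :
    partialSocle d (Fin.last n) = ∑ i, (d i - 1) := by
  rw [partialSocle]
  congr 1
  ext i
  simp [Fin.le_last]

/-- The span of an ideal `J` and of all the strings `w x_k^a` centered at half the socle degree
`e`. -/
noncomputable def stringSpan (J : Ideal (MvPolynomial (Fin (n + 1)) K)) (e : ℕ)
    (k : Fin (n + 1)) : Submodule K (MvPolynomial (Fin (n + 1)) K) :=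
  Submodule.span K {p | ∃ w, ∃ σ a : ℕ, w.IsHomogeneous σ ∧ 2 * σ ≤ e ∧
    w * X k ^ (e + 1 - 2 * σ) ∈ J ∧ p = w * X k ^ a} ⊔ J.restrictScalars K

/-- Each string of length `e + 1 - 2σ` in the old variable is recombined with the new binary form.
The resulting strings start in degree `σ + i` and are again centered, now at half of `e + (d k.succ
- 1)`. -/
theorem monomial_mem_stringSpan (c : Fin n → ℕ → K) (d : Fin (n + 1) → ℕ) (hd : ∀ i, d i ≠ 0)
    (hc : ∀ k : Fin n, (∀ t, d k.succ < t → c k t = 0) ∧ c k (d k.succ) ≠ 0 ∧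
      ∀ i < d k.succ, ∀ N ≤ partialSocle d k.castSucc + 1, (toeplitz (c k) i N).det ≠ 0)
    (k : Fin (n + 1)) (α : Fin (n + 1) →₀ ℕ) (hα : ∀ i, k < i → α i = 0) :
    monomial α (1 : K) ∈
      stringSpan (Ideal.span (Set.range (chainForms c d))) (partialSocle d k) k := by
  set J := Ideal.span (Set.range (chainForms c d)) with hJ
  induction k using Fin.induction generalizing α with
  | zero =>
    refine Submodule.mem_sup_left (Submodule.subset_span ⟨1, 0, α 0, isHomogeneous_one _ _,
      by omega, ?_, ?_⟩)
    · rw [partialSocle_zero, one_mul, show d 0 - 1 + 1 - 2 * 0 = d 0 by have := hd 0; omega]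
      exact Ideal.subset_span ⟨0, rfl⟩
    · rw [one_mul, X_pow_eq_monomial]
      refine congrArg (fun γ => monomial γ (1 : K)) (Finsupp.ext fun i => ?_)
      by_cases hi : i = 0
      · simp [hi]
      · rw [hα i (Fin.pos_of_ne_zero hi), Finsupp.single_eq_of_ne hi]
  | succ k ih =>
    obtain ⟨hc1, hc2, hc3⟩ := hc k
    have hdk := hd k.succ
    have hα' : monomial α (1 : K) = monomial (α.erase k.succ) 1 * X k.succ ^ α k.succ := by
      rw [X_pow_eq_monomial, monomial_mul, one_mul, Finsupp.erase_add_single]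
    have h1 := ih (α.erase k.succ) fun i hi => by
      by_cases hik : i = k.succ
      · rw [hik, Finsupp.erase_same]
      · rw [Finsupp.erase_ne hik]
        refine hα i ?_
        rw [Fin.lt_def, Fin.val_castSucc] at hi
        rw [Fin.ext_iff, Fin.val_succ] at hik
        rw [Fin.lt_def, Fin.val_succ]
        omega
    rw [hα']
    generalize α k.succ = b
    obtain ⟨u, hu, v, hv, huv⟩ := Submodule.mem_sup.1 h1
    rw [← huv, add_mul]
    refine add_mem ?_ (Submodule.mem_sup_right (J.mul_mem_right _ hv))
    clear huv
    induction hu using Submodule.span_induction with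
    | zero => rw [zero_mul]; exact zero_mem _
    | add p q _ _ hp hq => rw [add_mul]; exact add_mem hp hq
    | smul r p _ hp => rw [smul_mul_assoc]; exact Submodule.smul_mem _ _ hp
    | mem p hp =>
      obtain ⟨w, σ, a, hw, hσ, hwJ, rfl⟩ := hp
      rw [mul_assoc]
      set e := partialSocle d k.castSucc
      -- The two-variable lemma is applied inside the colon ideal `J : w`, where `x_k^(e+1-2σ)` lies
      -- by the choice of the string.
      refine monomial_mem_of_strings (R := MvPolynomial (Fin (n + 1)) K)
        (c := c k) (d := d k.succ) (s := e + 1 - 2 * σ) hc1 hc2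
        (fun i hi => hc3 i hi _ (by omega)) (x := X k.castSucc) (y := X k.succ)
        (I := Submodule.comap (LinearMap.mulLeft (MvPolynomial (Fin (n + 1)) K) w) J)
        hwJ (J.mul_mem_left _ (Ideal.subset_span ⟨k.succ, rfl⟩))
        ((stringSpan J (partialSocle d k.succ) k.succ).comap (LinearMap.mulLeft K w))
        (fun u hu => Submodule.mem_sup_right hu) ?_ a b
      intro i his hid q hq b
      refine Submodule.mem_sup_left (Submodule.subset_span
        ⟨w * (X k.castSucc ^ i + ∑ b ∈ Finset.range i, q b • (X k.castSucc ^ b *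
          X k.succ ^ (i - b))), σ + i, b, hw.mul ?_, ?_, ?_, ?_⟩)
      · refine (isHomogeneous_X_pow _ _).add (IsHomogeneous.sum _ _ _ fun t ht => ?_)
        have := Finset.mem_range.1 ht
        have h := (isHomogeneous_X_pow (R := K) k.castSucc t).mul
          (isHomogeneous_X_pow k.succ (i - t))
        rw [show t + (i - t) = i by omega] at h
        rw [smul_eq_C_mul]
        exact h.C_mul _
      -- Adding `i ≤ e - 2σ` and `i ≤ d k.succ - 1` gives the bound on the starting degree.
      · rw [partialSocle_succ]
        omega
      · rw [partialSocle_succ]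
        rw [show e + (d k.succ - 1) + 1 - 2 * (σ + i)
          = e + 1 - 2 * σ + d k.succ - 1 - 2 * i by omega, mul_assoc, mul_comm (_ + _)]
        exact hq
      · exact (mul_assoc _ _ _).symm

/-- Over an infinite field there are forms of given degrees such that multiplication by
`x_n^(δ-2j)` is onto in degree `δ - j` modulo these forms. -/
theorem exists_forms_monomial_mem [Infinite K] (d : Fin (n + 1) → ℕ) (hd : ∀ i, d i ≠ 0) :
    ∃ g : Fin (n + 1) → MvPolynomial (Fin (n + 1)) K, (∀ i, (g i).IsHomogeneous (d i)) ∧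
      ∀ j, 2 * j ≤ ∑ i, (d i - 1) → ∀ α : Fin (n + 1) →₀ ℕ, α.degree = ∑ i, (d i - 1) - j →
        monomial α (1 : K) ∈ Submodule.span K ((fun β => monomial β (1 : K)) ''
          {β | ∑ i, (d i - 1) - 2 * j ≤ β (Fin.last n)}) ⊔
            (Ideal.span (Set.range g)).restrictScalars K := by
  choose c hc using fun k : Fin n =>
    exists_toeplitz_det_ne_zero K (d k.succ) (partialSocle d k.castSucc + 1)
  have hg := isHomogeneous_chainForms c d
  refine ⟨chainForms c d, hg, fun j hj α hα => ?_⟩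
  have h1 := monomial_mem_stringSpan c d hd hc (Fin.last n) α
    (fun i hi => absurd hi (Fin.le_last i).not_gt)
  rw [partialSocle_last] at h1
  set δ := ∑ i, (d i - 1)
  have h2 : homogeneousComponent (δ - j) (monomial α (1 : K)) = monomial α 1 :=
    homogeneousComponent_eq_self (isHomogeneous_monomial _ hα)
  rw [← h2]
  obtain ⟨u, hu, v, hv, huv⟩ := Submodule.mem_sup.1 h1
  rw [← huv, map_add]
  refine add_mem ?_ (Submodule.mem_sup_right (homogeneousComponent_mem_span hg _ hv))
  clear huv
  induction hu using Submodule.span_induction with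
  | zero => rw [map_zero]; exact zero_mem _
  | add p q _ _ hp hq => rw [map_add]; exact add_mem hp hq
  | smul r p _ hp => rw [map_smul]; exact Submodule.smul_mem _ _ hp
  | mem p hp =>
    obtain ⟨w, σ, a, hw, hσ, hwJ, rfl⟩ := hp
    rw [homogeneousComponent_of_mem (hw.mul (isHomogeneous_X_pow _ _))]
    split_ifs with hdeg
    -- Past the end of the string the product is in the ideal. Otherwise `a ≤ δ - 2σ` and `σ + a = δ
    -- - j` give `σ ≤ j`, hence `a ≥ δ - 2j`.
    · by_cases ha : δ + 1 - 2 * σ ≤ a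
      · refine Submodule.mem_sup_right ?_
        rw [← Nat.add_sub_cancel' ha, pow_add, ← mul_assoc]
        exact Ideal.mul_mem_right _ _ hwJ
      · refine Submodule.mem_sup_left ?_
        rw [w.as_sum, Finset.sum_mul]
        refine Submodule.sum_mem _ fun γ _ => ?_
        rw [X_pow_eq_monomial, monomial_mul, mul_one, monomial_eq_smul]
        refine Submodule.smul_mem _ _ (Submodule.subset_span ⟨_, ?_, rfl⟩)
        rw [Set.mem_ofPred_eq, Finsupp.add_apply, Finsupp.single_eq_same]
        omega
    · exact zero_mem _

end Chain

/-! ### Monomial bases and Hilbert functions -/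

section MonomialBasis

variable {K : Type*} [Field K] {n : ℕ}

theorem homogeneousComponent_mem_restrictSupport {T : Set (Fin n →₀ ℕ)} (m : ℕ)
    {u : MvPolynomial (Fin n) K} (hu : u ∈ restrictSupport K T) :
    homogeneousComponent m u ∈ restrictSupport K {α ∈ T | α.degree = m} := by
  classical
  rw [mem_restrictSupport_iff] at hu ⊢
  intro α hα
  rw [Finset.mem_coe, mem_support_iff, coeff_homogeneousComponent] at hα
  have h1 : α.degree = m := by
    by_contra h
    exact hα (if_neg h)
  rw [if_pos h1] at hα
  exact ⟨hu (mem_support_iff.2 hα), h1⟩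

/-- If the monomials in `T` form a basis of `R/J`, then those of degree `m` form a basis of the
component of degree `m`. -/
theorem finrank_gradedPiece_eq_ncard {J : Ideal (MvPolynomial (Fin n) K)}
    (hJ : ∀ m, ∀ u ∈ J, homogeneousComponent m u ∈ J) {T : Set (Fin n →₀ ℕ)}
    (hT : IsCompl (restrictSupport K T) (J.restrictScalars K)) (m : ℕ) :
    Module.finrank K (gradedPiece J m) = {α ∈ T | α.degree = m}.ncard := by
  have hmap : gradedPiece J m = (restrictSupport K {α ∈ T | α.degree = m}).map
      (Ideal.Quotient.mkₐ K J).toLinearMap := by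
    refine le_antisymm ?_ (Submodule.map_mono fun p hp => ?_)
    · rintro _ ⟨p, hp, rfl⟩
      obtain ⟨u, hu, v, hv, huv⟩ := Submodule.mem_sup.1
        (hT.sup_eq_top ▸ Submodule.mem_top : p ∈ restrictSupport K T ⊔ J.restrictScalars K)
      refine ⟨homogeneousComponent m u, homogeneousComponent_mem_restrictSupport m hu, ?_⟩
      rw [← homogeneousComponent_eq_self ((mem_homogeneousSubmodule m p).1 hp), ← huv, map_add,
        map_add]
      have : (Ideal.Quotient.mkₐ K J).toLinearMap (homogeneousComponent m v) = 0 :=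
        Ideal.Quotient.eq_zero_iff_mem.2 (hJ m v hv)
      rw [this, add_zero]
    · rw [mem_homogeneousSubmodule]
      intro α hα
      have := ((mem_restrictSupport_iff K).1 hp (mem_support_iff.2 hα)).2
      rwa [Finsupp.degree_eq_weight_one] at this
  have hinj : Function.Injective ((Ideal.Quotient.mkₐ K J).toLinearMap.domRestrict
      (restrictSupport K {α ∈ T | α.degree = m})) := by
    rw [← LinearMap.ker_eq_bot, LinearMap.ker_eq_bot']
    rintro ⟨u, hu⟩ h0
    have h1 : u ∈ J := Ideal.Quotient.eq_zero_iff_mem.1 h0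
    have h2 := Submodule.disjoint_def.1 hT.disjoint u
      (restrictSupport_mono K (Set.sep_subset _ _) hu) h1
    exact Subtype.ext h2
  rw [hmap, ← LinearMap.range_domRestrict, LinearMap.finrank_range_of_inj hinj,
    Module.finrank_eq_nat_card_basis (basisRestrictSupport K _)]
  rfl

end MonomialBasis

/-! ### The box basis of a complete intersection -/

section CompleteIntersection

variable {K : Type*} [Field K] {n : ℕ}

/-- The exponent vectors with `i`-th exponent less than `d i`. -/
def box (d : Fin n → ℕ) : Set (Fin n →₀ ℕ) := {α | ∀ i, α i < d i}

/-- The product of the remainder of `x^α` in the box and of the powers of the `f i` given by the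
quotients. -/
noncomputable def boxProd (f : Fin n → MvPolynomial (Fin n) K) (d : Fin n → ℕ)
    (α : Fin n →₀ ℕ) : MvPolynomial (Fin n) K :=
  monomial (Finsupp.equivFunOnFinite.symm fun i => α i % d i) 1 * ∏ i, f i ^ (α i / d i)

theorem boxProd_of_mem (f : Fin n → MvPolynomial (Fin n) K) {d : Fin n → ℕ} {α : Fin n →₀ ℕ}
    (hα : α ∈ box d) : boxProd f d α = monomial α 1 := by
  rw [boxProd, Finset.prod_eq_one fun i _ => by rw [Nat.div_eq_of_lt (hα i), pow_zero], mul_one]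
  refine congrArg (fun γ => monomial γ (1 : K)) (Finsupp.ext fun i => ?_)
  simp [Nat.mod_eq_of_lt (hα i)]

theorem boxProd_add_single (f : Fin n → MvPolynomial (Fin n) K) {d : Fin n → ℕ}
    (hd : ∀ i, d i ≠ 0) (α : Fin n →₀ ℕ) (i : Fin n) :
    boxProd f d (α + Finsupp.single i (d i)) = f i * boxProd f d α := by
  classical
  rw [boxProd, boxProd, mul_left_comm]
  congr 1
  · refine congrArg (fun γ => monomial γ (1 : K)) (Finsupp.ext fun j => ?_)
    by_cases hj : j = i
    · subst hj; simp
    · simp [Finsupp.single_eq_of_ne hj]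
  · rw [← Finset.mul_prod_erase _ _ (Finset.mem_univ i),
      ← Finset.mul_prod_erase _ (fun j => f j ^ (α j / d j)) (Finset.mem_univ i), ← mul_assoc]
    congr 1
    · rw [Finsupp.add_apply, Finsupp.single_eq_same,
        Nat.add_div_right _ (Nat.pos_of_ne_zero (hd i)), pow_succ']
    · refine Finset.prod_congr rfl fun j hj => ?_
      rw [Finsupp.add_apply, Finsupp.single_eq_of_ne (Finset.ne_of_mem_erase hj), add_zero]

theorem isHomogeneous_boxProd {f : Fin n → MvPolynomial (Fin n) K} {d : Fin n → ℕ}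
    (hf : ∀ i, (f i).IsHomogeneous (d i)) (α : Fin n →₀ ℕ) :
    (boxProd f d α).IsHomogeneous α.degree := by
  have h := (isHomogeneous_monomial (R := K)
    (d := Finsupp.equivFunOnFinite.symm fun i => α i % d i) 1 rfl).mul
    (IsHomogeneous.prod Finset.univ (fun i => f i ^ (α i / d i)) (fun i => d i * (α i / d i))
      fun i _ => (hf i).pow _)
  rw [Finsupp.degree_eq_sum, ← Finset.sum_add_distrib] at h
  rw [Finsupp.degree_eq_sum]
  convert! h using 2 with i
  exact (Nat.mod_add_div (α i) (d i)).symm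

/-- The linear map sending `x^α` to `boxProd f d α`. -/
noncomputable def boxMap (f : Fin n → MvPolynomial (Fin n) K) (d : Fin n → ℕ) :
    MvPolynomial (Fin n) K →ₗ[K] MvPolynomial (Fin n) K :=
  (basisMonomials (Fin n) K).constr K (boxProd f d)

theorem boxMap_monomial (f : Fin n → MvPolynomial (Fin n) K) (d : Fin n → ℕ) (α : Fin n →₀ ℕ) :
    boxMap f d (monomial α 1) = boxProd f d α := by
  have := (basisMonomials (Fin n) K).constr_basis K (boxProd f d) α
  rwa [coe_basisMonomials] at this

/-- The map intertwines multiplication by `x_i^(d i)` with multiplication by `f i`, so it compares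
the polynomial ring as a module over the two subalgebras generated by these elements. -/
theorem mul_boxMap (f : Fin n → MvPolynomial (Fin n) K) {d : Fin n → ℕ} (hd : ∀ i, d i ≠ 0)
    (i : Fin n) (p : MvPolynomial (Fin n) K) :
    f i * boxMap f d p = boxMap f d (monomial (Finsupp.single i (d i)) 1 * p) := by
  rw [p.as_sum, map_sum, Finset.mul_sum, Finset.mul_sum, map_sum]
  refine Finset.sum_congr rfl fun α _ => ?_
  rw [monomial_mul, one_mul, monomial_eq_smul, map_smul, boxMap_monomial, monomial_eq_smul _ (coeff α p),
    map_smul, boxMap_monomial, add_comm, boxProd_add_single f hd, mul_smul_comm]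

theorem homogeneousComponent_boxMap {f : Fin n → MvPolynomial (Fin n) K} {d : Fin n → ℕ}
    (hf : ∀ i, (f i).IsHomogeneous (d i)) (m : ℕ) (p : MvPolynomial (Fin n) K) :
    homogeneousComponent m (boxMap f d p) = boxMap f d (homogeneousComponent m p) := by
  rw [p.as_sum, map_sum, map_sum, map_sum, map_sum]
  refine Finset.sum_congr rfl fun α _ => ?_
  rw [monomial_eq_smul, map_smul, map_smul, map_smul, map_smul, boxMap_monomial,
    homogeneousComponent_of_mem (isHomogeneous_boxProd hf α),
    homogeneousComponent_of_mem (isHomogeneous_monomial (R := K) (d := α) 1 rfl)]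
  split_ifs
  · rw [boxMap_monomial]
  · rw [map_zero]

theorem boxMap_eq_self (f : Fin n → MvPolynomial (Fin n) K) {d : Fin n → ℕ}
    {u : MvPolynomial (Fin n) K} (hu : u ∈ restrictSupport K (box d)) : boxMap f d u = u := by
  conv_lhs => rw [u.as_sum, map_sum]
  conv_rhs => rw [u.as_sum]
  refine Finset.sum_congr rfl fun α hα => ?_
  rw [monomial_eq_smul, map_smul, boxMap_monomial, boxProd_of_mem f (hu hα)]

/-- Modulo the box, a monomial is a combination of products of some `f i` with monomials of smaller
degree, as `d i > 0`; those are in the range by induction, and the range is stable under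
multiplication by `f i`. -/
theorem boxMap_surjective {f : Fin n → MvPolynomial (Fin n) K} {d : Fin n → ℕ}
    (hd : ∀ i, d i ≠ 0) (hf : ∀ i, (f i).IsHomogeneous (d i))
    (hspan : ∀ α, monomial α (1 : K) ∈ restrictSupport K (box d) ⊔
      (Ideal.span (Set.range f)).restrictScalars K) : Function.Surjective (boxMap f d) := by
  have key : ∀ m : ℕ, ∀ α : Fin n →₀ ℕ, α.degree = m →
      monomial α (1 : K) ∈ LinearMap.range (boxMap f d) := by
    intro m
    induction m using Nat.strong_induction_on with
    | _ m ih =>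
      intro α hα
      obtain ⟨u, hu, v, hv, huv⟩ := Submodule.mem_sup.1 (hspan α)
      rw [← homogeneousComponent_eq_self (isHomogeneous_monomial (1 : K) hα), ← huv, map_add]
      refine add_mem ?_ ?_
      · rw [← boxMap_eq_self f hu, homogeneousComponent_boxMap hf]
        exact ⟨_, rfl⟩
      · refine Submodule.span_le.2 ?_ (homogeneousComponent_mem_macaulay hf m hv)
        rintro _ ⟨i, γ, hγ, rfl⟩
        obtain ⟨p, hp⟩ := ih γ.degree (by have := hd i; omega) γ rfl
        rw [← hp, mul_comm, mul_boxMap f hd]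
        exact ⟨_, rfl⟩
  intro p
  rw [← LinearMap.mem_range, p.as_sum]
  refine Submodule.sum_mem _ fun α _ => ?_
  rw [monomial_eq_smul]
  exact Submodule.smul_mem _ _ (key _ α rfl)

/-- The map preserves degrees and each homogeneous component is finite-dimensional, so surjectivity
there gives injectivity. -/
theorem boxMap_injective {f : Fin n → MvPolynomial (Fin n) K} {d : Fin n → ℕ}
    (hf : ∀ i, (f i).IsHomogeneous (d i)) (hsurj : Function.Surjective (boxMap f d)) :
    Function.Injective (boxMap f d) := by
  have hmaps : ∀ m, ∀ p ∈ homogeneousSubmodule (Fin n) K m,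
      boxMap f d p ∈ homogeneousSubmodule (Fin n) K m := by
    intro m p hp
    rw [mem_homogeneousSubmodule] at hp ⊢
    rw [← homogeneousComponent_eq_self hp, ← homogeneousComponent_boxMap hf]
    exact homogeneousComponent_isHomogeneous _ _
  have hinj : ∀ m, Function.Injective ((boxMap f d).restrict (hmaps m)) := by
    intro m
    have : FiniteDimensional K (homogeneousSubmodule (Fin n) K m) :=
      Module.Finite.iff_fg.2 (homogeneousSubmodule_fg (Fin n) K m)
    refine LinearMap.injective_iff_surjective.2 ?_
    rintro ⟨q, hq⟩
    obtain ⟨p, rfl⟩ := hsurj q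
    refine ⟨⟨homogeneousComponent m p, homogeneousComponent_mem m p⟩, Subtype.ext ?_⟩
    rw [LinearMap.coe_restrict_apply, ← homogeneousComponent_boxMap hf]
    exact homogeneousComponent_eq_self ((mem_homogeneousSubmodule m _).1 hq)
  rw [injective_iff_map_eq_zero]
  intro p hp
  rw [← sum_homogeneousComponent p]
  refine Finset.sum_eq_zero fun m _ => ?_
  have h1 : (boxMap f d).restrict (hmaps m)
      ⟨homogeneousComponent m p, homogeneousComponent_mem m p⟩ = 0 := by
    refine Subtype.ext ?_
    rw [LinearMap.coe_restrict_apply, ← homogeneousComponent_boxMap hf, hp, map_zero]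
    rfl
  exact congrArg Subtype.val ((injective_iff_map_eq_zero _).1 (hinj m) _ h1)

/-- If the monomials in the box span modulo `n` forms of degrees `d i` in `n` variables, then they
form a basis. -/
theorem isCompl_box {f : Fin n → MvPolynomial (Fin n) K} {d : Fin n → ℕ}
    (hd : ∀ i, d i ≠ 0) (hf : ∀ i, (f i).IsHomogeneous (d i))
    (hspan : ∀ α, monomial α (1 : K) ∈ restrictSupport K (box d) ⊔
      (Ideal.span (Set.range f)).restrictScalars K) :
    IsCompl (restrictSupport K (box d)) ((Ideal.span (Set.range f)).restrictScalars K) := by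
  have hsurj := boxMap_surjective hd hf hspan
  have hinj := boxMap_injective hf hsurj
  refine ⟨Submodule.disjoint_def.2 fun u hu huJ => ?_, codisjoint_iff.2 (top_le_iff.1 ?_)⟩
  -- An element of the ideal is the image of a polynomial supported off the box, whereas one
  -- supported in the box is its own image; injectivity identifies the two preimages.
  · have h1 : u ∈ (restrictSupport K (box d)ᶜ).map (boxMap f d) := by
      rw [Submodule.restrictScalars_mem, Ideal.span,
        Submodule.mem_span_range_iff_exists_fun] at huJ
      obtain ⟨c, rfl⟩ := huJ
      refine Submodule.sum_mem _ fun i _ => ?_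
      obtain ⟨p, hp⟩ := hsurj (c i)
      refine ⟨monomial (Finsupp.single i (d i)) 1 * p, ?_, ?_⟩
      · rw [SetLike.mem_coe, mem_restrictSupport_iff]
        intro α hα hbox
        rw [Finset.mem_coe, mem_support_iff, coeff_monomial_mul'] at hα
        have h2 : Finsupp.single i (d i) ≤ α := by
          by_contra h
          exact hα (if_neg h)
        have h3 := h2 i
        rw [Finsupp.single_eq_same] at h3
        exact absurd (hbox i) (by omega)
      · rw [← mul_boxMap f hd, hp, smul_eq_mul, mul_comm]
    obtain ⟨w, hw, hwu⟩ := h1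
    have h2 : w = u := hinj (hwu.trans (boxMap_eq_self f hu).symm)
    subst h2
    rw [← support_eq_empty, Finset.eq_empty_iff_forall_notMem]
    exact fun α hα => hw hα (hu hα)
  · intro p _
    rw [p.as_sum]
    refine Submodule.sum_mem _ fun α _ => ?_
    rw [monomial_eq_smul]
    exact Submodule.smul_mem _ _ (hspan α)

/-- The Hilbert function of a complete intersection is symmetric. -/
theorem ncard_box_symm (d : Fin n → ℕ) {i j : ℕ} (hij : i + j = ∑ k, (d k - 1)) :
    {α ∈ box d | α.degree = i}.ncard = {α ∈ box d | α.degree = j}.ncard := by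
  -- Reflection of the box through its center.
  let τ : (Fin n →₀ ℕ) → (Fin n →₀ ℕ) := fun α =>
    Finsupp.equivFunOnFinite.symm fun k => d k - 1 - α k
  have hτ : ∀ α k, τ α k = d k - 1 - α k := fun α k => rfl
  have hmem : ∀ i j, i + j = ∑ k, (d k - 1) → ∀ α ∈ {α ∈ box d | α.degree = i},
      τ α ∈ {α ∈ box d | α.degree = j} := by
    rintro i j hij α ⟨hα, hdeg⟩
    refine ⟨fun k => ?_, ?_⟩
    · have := hα k
      rw [hτ]
      omega
    · have h1 : (τ α).degree + α.degree = ∑ k, (d k - 1) := by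
        rw [Finsupp.degree_eq_sum, Finsupp.degree_eq_sum, ← Finset.sum_add_distrib]
        refine Finset.sum_congr rfl fun k _ => ?_
        have := hα k
        rw [hτ]
        omega
      omega
  have hinv : ∀ α ∈ box d, τ (τ α) = α := by
    intro α hα
    ext k
    have := hα k
    rw [hτ, hτ]
    omega
  refine Set.ncard_congr (fun α _ => τ α) (hmem i j hij) ?_ ?_
  · intro α β hα hβ h
    rw [← hinv α hα.1, ← hinv β hβ.1]
    exact congrArg τ h
  · intro β hβ
    exact ⟨τ β, hmem j i (by omega) β hβ, hinv β hβ.1⟩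

theorem box_degree_le {d : Fin n → ℕ} {α : Fin n →₀ ℕ} (hα : α ∈ box d) :
    α.degree ≤ ∑ k, (d k - 1) := by
  rw [Finsupp.degree_eq_sum]
  refine Finset.sum_le_sum fun k _ => ?_
  have := hα k
  omega

end CompleteIntersection

/-! ### Multiplication maps in terms of polynomials -/

section Multiplication

variable {K : Type*} [Field K] {n : ℕ}

theorem degree_eq_of_mem_support {p : MvPolynomial (Fin n) K} {m : ℕ} (hp : p.IsHomogeneous m)
    {α : Fin n →₀ ℕ} (hα : α ∈ p.support) : α.degree = m :=
  by_contra fun h => mem_support_iff.1 hα (hp.coeff_eq_zero h)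

theorem injective_mulMap_iff (J : Ideal (MvPolynomial (Fin n) K)) {L : MvPolynomial (Fin n) K}
    {r : ℕ} (hL : L.IsHomogeneous r) (j : ℕ) :
    Function.Injective (mulMap J hL j) ↔ ∀ p, p.IsHomogeneous j → L * p ∈ J → p ∈ J := by
  rw [injective_iff_map_eq_zero]
  constructor
  · intro h p hp hLp
    have h1 := h ⟨Ideal.Quotient.mk J p, p, hp, rfl⟩ (Subtype.ext (by
      change Ideal.Quotient.mk J L * Ideal.Quotient.mk J p = 0
      rw [← map_mul]
      exact Ideal.Quotient.eq_zero_iff_mem.2 hLp))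
    exact Ideal.Quotient.eq_zero_iff_mem.1 (congrArg Subtype.val h1)
  · rintro h ⟨_, p, hp, rfl⟩ h0
    have h1 : Ideal.Quotient.mk J L * Ideal.Quotient.mk J p = 0 := congrArg Subtype.val h0
    rw [← map_mul, Ideal.Quotient.eq_zero_iff_mem] at h1
    exact Subtype.ext (Ideal.Quotient.eq_zero_iff_mem.2 (h p hp h1))

theorem surjective_mulMap_iff (J : Ideal (MvPolynomial (Fin n) K)) {L : MvPolynomial (Fin n) K}
    {r : ℕ} (hL : L.IsHomogeneous r) (j : ℕ) :
    Function.Surjective (mulMap J hL j) ↔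
      ∀ p, p.IsHomogeneous (j + r) → ∃ q, q.IsHomogeneous j ∧ p - L * q ∈ J := by
  constructor
  · intro h p hp
    obtain ⟨⟨_, q, hq, rfl⟩, hqp⟩ := h ⟨Ideal.Quotient.mk J p, p, hp, rfl⟩
    have h1 : Ideal.Quotient.mk J L * Ideal.Quotient.mk J q = Ideal.Quotient.mk J p :=
      congrArg Subtype.val hqp
    rw [← map_mul] at h1
    exact ⟨q, hq, Ideal.Quotient.eq.1 h1.symm⟩
  · rintro h ⟨_, p, hp, rfl⟩
    obtain ⟨q, hq, hqp⟩ := h p hp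
    refine ⟨⟨Ideal.Quotient.mk J q, q, hq, rfl⟩, Subtype.ext ?_⟩
    change Ideal.Quotient.mk J L * Ideal.Quotient.mk J q = Ideal.Quotient.mk J p
    rw [← map_mul]
    exact (Ideal.Quotient.eq.2 hqp).symm

instance (J : Ideal (MvPolynomial (Fin n) K)) (j : ℕ) : Module.Finite K (gradedPiece J j) :=
  Module.Finite.iff_fg.2 ((homogeneousSubmodule_fg (Fin n) K j).map _)

theorem homogeneousComponent_X_pow_mul (i : Fin n) (r j : ℕ) (q : MvPolynomial (Fin n) K) :
    homogeneousComponent (j + r) (X i ^ r * q) = X i ^ r * homogeneousComponent j q := by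
  rw [q.as_sum, Finset.mul_sum, map_sum, map_sum, Finset.mul_sum]
  refine Finset.sum_congr rfl fun α _ => ?_
  have h := (isHomogeneous_X_pow (R := K) i r).mul
    (isHomogeneous_monomial (d := α) (coeff α q) rfl)
  rw [homogeneousComponent_of_mem h,
    homogeneousComponent_of_mem (isHomogeneous_monomial (d := α) (coeff α q) rfl)]
  split_ifs <;> first | rfl | omega | rw [mul_zero]

theorem X_pow_dvd_of_support {i : Fin n} {r : ℕ} {p : MvPolynomial (Fin n) K}
    (h : ∀ α ∈ p.support, r ≤ α i) : X i ^ r ∣ p := by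
  rw [p.as_sum]
  refine Finset.dvd_sum fun α hα => ?_
  refine ⟨monomial (α - Finsupp.single i r) (coeff α p), ?_⟩
  rw [X_pow_eq_monomial, monomial_mul, one_mul, add_tsub_cancel_of_le]
  exact Finsupp.single_le_iff.2 (h α hα)

theorem exists_eq_X_pow_mul {i : Fin n} {r j : ℕ} {p : MvPolynomial (Fin n) K}
    (hp : p.IsHomogeneous (j + r)) (h : ∀ α ∈ p.support, r ≤ α i) :
    ∃ q : MvPolynomial (Fin n) K, q.IsHomogeneous j ∧ p = X i ^ r * q := by
  obtain ⟨q, rfl⟩ := X_pow_dvd_of_support h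
  refine ⟨homogeneousComponent j q, homogeneousComponent_isHomogeneous _ _, ?_⟩
  rw [← homogeneousComponent_X_pow_mul, homogeneousComponent_eq_self hp]

end Multiplication

/-! ### From the central maps to the strong Lefschetz property -/

section Lefschetz

variable {K : Type*} [Field K] {n : ℕ}

/-- If the monomials in the box form a basis of `R/J`, then `J` contains all forms of degree
greater than the socle degree. -/
theorem mem_of_isCompl_box {J : Ideal (MvPolynomial (Fin n) K)}
    (hJ : ∀ m, ∀ u ∈ J, homogeneousComponent m u ∈ J) {d : Fin n → ℕ}
    (hbox : IsCompl (restrictSupport K (box d)) (J.restrictScalars K)) {m : ℕ}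
    (hm : ∑ k, (d k - 1) < m) {p : MvPolynomial (Fin n) K} (hp : p.IsHomogeneous m) : p ∈ J := by
  obtain ⟨u, hu, v, hv, huv⟩ := Submodule.mem_sup.1
    (hbox.sup_eq_top ▸ Submodule.mem_top : p ∈ restrictSupport K (box d) ⊔ J.restrictScalars K)
  rw [← homogeneousComponent_eq_self hp, ← huv, map_add]
  refine J.add_mem ?_ (hJ m v hv)
  have h0 : homogeneousComponent m u = 0 := by
    rw [← support_eq_empty, Finset.eq_empty_iff_forall_notMem]
    intro α hα
    have h1 := homogeneousComponent_mem_restrictSupport m hu hα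
    have := box_degree_le h1.1
    have := h1.2
    omega
  rw [h0]
  exact J.zero_mem

/-- A complete intersection on which `x_i^(δ-2j)` is onto in degree `δ - j` for all `j ≤ δ/2` has
the strong Lefschetz property for `x_i`. -/
theorem lefschetz_of_central {J : Ideal (MvPolynomial (Fin n) K)}
    (hJ : ∀ m, ∀ u ∈ J, homogeneousComponent m u ∈ J) {d : Fin n → ℕ}
    (hbox : IsCompl (restrictSupport K (box d)) (J.restrictScalars K)) (l : Fin n)
    (hcentral : ∀ j, 2 * j ≤ ∑ i, (d i - 1) → ∀ α : Fin n →₀ ℕ,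
      α.degree = ∑ i, (d i - 1) - j → monomial α (1 : K) ∈
        restrictSupport K {β | ∑ i, (d i - 1) - 2 * j ≤ β l} ⊔ J.restrictScalars K) (i r : ℕ) :
    (2 * i + r ≤ ∑ i, (d i - 1) → Function.Injective
      (mulMap J (isHomogeneous_linear_pow (isHomogeneous_X K l) r) i)) ∧
    (∑ i, (d i - 1) ≤ 2 * i + r → Function.Surjective
      (mulMap J (isHomogeneous_linear_pow (isHomogeneous_X K l) r) i)) := by
  set δ := ∑ i, (d i - 1) with hδ
  have hsurj : ∀ j, 2 * j ≤ δ → Function.Surjective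
      (mulMap J (isHomogeneous_linear_pow (isHomogeneous_X K l) (δ - 2 * j)) j) := by
    intro j hj
    rw [surjective_mulMap_iff]
    intro p hp
    have hp2 : p ∈ restrictSupport K {β | δ - 2 * j ≤ β l} ⊔ J.restrictScalars K := by
      rw [p.as_sum]
      refine Submodule.sum_mem _ fun α hα => ?_
      rw [monomial_eq_smul]
      refine Submodule.smul_mem _ _ (hcentral j hj α ?_)
      rw [degree_eq_of_mem_support hp hα]
      omega
    obtain ⟨u, hu, v, hv, huv⟩ := Submodule.mem_sup.1 hp2
    obtain ⟨q, hq, hqu⟩ := exists_eq_X_pow_mul (i := l)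
      (homogeneousComponent_isHomogeneous (j + (δ - 2 * j)) u)
      fun α hα => (homogeneousComponent_mem_restrictSupport _ hu hα).1
    refine ⟨q, hq, ?_⟩
    rw [← hqu, ← homogeneousComponent_eq_self hp, ← huv, map_add, add_sub_cancel_left]
    exact hJ _ v hv
  constructor
  · intro hir
    have hfin : Module.finrank K (gradedPiece J i)
        = Module.finrank K (gradedPiece J (i + (δ - 2 * i))) := by
      rw [finrank_gradedPiece_eq_ncard hJ hbox, finrank_gradedPiece_eq_ncard hJ hbox]
      exact ncard_box_symm d (by omega)
    have hinj := (LinearMap.injective_iff_surjective_of_finrank_eq_finrank hfin).2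
      (hsurj i (by omega))
    rw [injective_mulMap_iff] at hinj ⊢
    intro p hp hXp
    refine hinj p hp ?_
    -- Here `x^r` is the first factor of the injective central map out of degree `i`.
    rw [show δ - 2 * i = (δ - 2 * i - r) + r by omega, pow_add, mul_assoc]
    exact J.mul_mem_left _ hXp
  · intro hir
    rw [surjective_mulMap_iff]
    intro p hp
    by_cases hδ' : δ < i + r
    · exact ⟨0, isHomogeneous_zero _ _ _, by
        rw [mul_zero, sub_zero]; exact mem_of_isCompl_box hJ hbox hδ' hp⟩
    -- Here `x^r` is the last factor of the surjective central map into degree `i + r`.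
    · have h1 := hsurj (δ - (i + r)) (by omega)
      rw [surjective_mulMap_iff] at h1
      obtain ⟨q, hq, hqp⟩ := h1 p (by convert hp using 1; omega)
      refine ⟨X l ^ (δ - 2 * (δ - (i + r)) - r) * q, ?_, ?_⟩
      · convert (isHomogeneous_X_pow (R := K) l (δ - 2 * (δ - (i + r)) - r)).mul hq using 1
        omega
      · rwa [← mul_assoc, ← pow_add,
          show r + (δ - 2 * (δ - (i + r)) - r) = δ - 2 * (δ - (i + r)) by omega]

theorem finite_quotient_of_isCompl_box {J : Ideal (MvPolynomial (Fin n) K)} {d : Fin n → ℕ}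
    (hbox : IsCompl (restrictSupport K (box d)) (J.restrictScalars K)) :
    Module.Finite K (MvPolynomial (Fin n) K ⧸ J) := by
  have hfin : (box d).Finite :=
    (Finsupp.finite_of_degree_le (σ := Fin n) (∑ k, (d k - 1))).subset fun α hα =>
      box_degree_le hα
  have : Finite (box d) := hfin
  have : Module.Finite K (restrictSupport K (box d)) :=
    Module.Finite.of_basis (basisRestrictSupport K (box d))
  refine Module.Finite.of_surjective
    ((Ideal.Quotient.mkₐ K J).toLinearMap.domRestrict (restrictSupport K (box d))) fun a => ?_
  obtain ⟨p, rfl⟩ := Ideal.Quotient.mk_surjective a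
  obtain ⟨u, hu, v, hv, huv⟩ := Submodule.mem_sup.1
    (hbox.sup_eq_top ▸ Submodule.mem_top : p ∈ restrictSupport K (box d) ⊔ J.restrictScalars K)
  refine ⟨⟨u, hu⟩, ?_⟩
  change Ideal.Quotient.mk J u = Ideal.Quotient.mk J p
  refine Ideal.Quotient.eq.2 ?_
  rw [← huv, ← neg_mem_iff, neg_sub, add_sub_cancel_left]
  exact hv

end Lefschetz

/-! ### Transfer to generic ideals -/

section Generic

variable {F K : Type*} [Field F] [Field K] [Algebra F K] {n : ℕ}

/-- The monomials in the box form a basis modulo a generic ideal of `n` forms. -/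
theorem isCompl_box_of_generic {d : Fin n → ℕ} (hd : ∀ i, d i ≠ 0)
    {f : Fin n → MvPolynomial (Fin n) K} (hf : ∀ i, (f i).IsHomogeneous (d i))
    (hind : AlgebraicIndependent F
      (fun p : (i : Fin n) × {a : Fin n →₀ ℕ // a.degree = d i} => (f p.1).coeff p.2.1)) :
    IsCompl (restrictSupport K (box d)) ((Ideal.span (Set.range f)).restrictScalars K) := by
  refine isCompl_box hd hf fun α => ?_
  rw [restrictSupport_eq_span]
  refine monomial_mem_of_specialization (g := fun i => X i ^ d i) hf
    (fun i => isHomogeneous_X_pow i (d i)) hind α.degree (box d) (fun β _ => ?_) α rfl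
  by_cases hβ : β ∈ box d
  · exact Submodule.mem_sup_left (Submodule.subset_span ⟨β, hβ, rfl⟩)
  · simp only [box, Set.mem_ofPred_eq, not_forall, not_lt] at hβ
    obtain ⟨i, hi⟩ := hβ
    refine Submodule.mem_sup_right ?_
    rw [← add_tsub_cancel_of_le (Finsupp.single_le_iff.2 hi), ← one_mul (1 : K), ← monomial_mul,
      ← X_pow_eq_monomial]
    exact Ideal.mul_mem_right _ _ (Ideal.subset_span ⟨i, rfl⟩)

/-- The strong Lefschetz property of a generic ideal of `n + 1` forms in `n + 1` variables. -/
theorem lefschetz_of_generic {d : Fin (n + 1) → ℕ} (hd : ∀ i, d i ≠ 0)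
    {f : Fin (n + 1) → MvPolynomial (Fin (n + 1)) K} (hf : ∀ i, (f i).IsHomogeneous (d i))
    (hind : AlgebraicIndependent F (fun p : (i : Fin (n + 1)) ×
      {a : Fin (n + 1) →₀ ℕ // a.degree = d i} => (f p.1).coeff p.2.1)) (i r : ℕ) :
    (2 * i + r ≤ ∑ i, (d i - 1) → Function.Injective (mulMap (Ideal.span (Set.range f))
      (isHomogeneous_linear_pow (isHomogeneous_X K (Fin.last n)) r) i)) ∧
    (∑ i, (d i - 1) ≤ 2 * i + r → Function.Surjective (mulMap (Ideal.span (Set.range f))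
      (isHomogeneous_linear_pow (isHomogeneous_X K (Fin.last n)) r) i)) := by
  have : Nonempty ((i : Fin (n + 1)) × {a : Fin (n + 1) →₀ ℕ // a.degree = d i}) :=
    ⟨⟨0, Finsupp.single 0 (d 0), Finsupp.degree_single _ _⟩⟩
  have : Infinite K := infinite_of_algebraicIndependent hind
  obtain ⟨g, hg, hcentral⟩ := exists_forms_monomial_mem (K := K) d hd
  refine lefschetz_of_central (fun m u hu => homogeneousComponent_mem_span hf m hu)
    (isCompl_box_of_generic hd hf hind) (Fin.last n) (fun j hj α hα => ?_) i r
  rw [restrictSupport_eq_span]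
  exact monomial_mem_of_specialization hf hg hind _ _ (hcentral j hj) α hα

end Generic

/-! ### Initial ideals and standard monomials -/

section Initial

variable {K : Type*} [Field K] {n : ℕ}

/-- The exponent vectors of the monomials outside the initial ideal. -/
def standardSet (J : Ideal (MvPolynomial (Fin n) K)) : Set (Fin n →₀ ℕ) :=
  {α | monomial α (1 : K) ∉ initialIdeal J}

theorem standardMonomials_eq (J : Ideal (MvPolynomial (Fin n) K)) (j : ℕ) :
    standardMonomials J j = {α ∈ standardSet J | α.degree = j} := by
  ext α
  exact and_comm

theorem degree_eq_of_forall_le {m : MonomialOrder (Fin n)} {p : MvPolynomial (Fin n) K}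
    {α : Fin n →₀ ℕ} (h0 : coeff α p ≠ 0) (h : ∀ β ∈ p.support, β ≼[m] α) : m.degree p = α := by
  refine m.toSyn.injective (le_antisymm ?_ (m.le_degree (mem_support_iff.2 h0)))
  exact m.degree_le_iff.2 h

/-- The initial ideal is a monomial ideal, so a monomial in it is divisible by the leading monomial
of some `p` in `J`; multiplying `p` by the quotient gives the required element. -/
theorem monomial_mem_initialIdeal_iff (J : Ideal (MvPolynomial (Fin n) K)) (α : Fin n →₀ ℕ) :
    monomial α (1 : K) ∈ initialIdeal J ↔ ∃ p ∈ J, p ≠ 0 ∧ (grevlex n).degree p = α := by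
  constructor
  · intro h
    have hle : initialIdeal J ≤ Ideal.span ((fun β => monomial β (1 : K)) ''
        {β | ∃ p ∈ J, p ≠ 0 ∧ (grevlex n).degree p = β}) := by
      refine Ideal.span_le.2 ?_
      rintro _ ⟨p, hp, rfl⟩
      by_cases hp0 : p = 0
      · rw [hp0, MonomialOrder.leadingTerm_zero]
        exact zero_mem _
      · rw [MonomialOrder.leadingTerm, monomial_eq_smul, smul_eq_C_mul]
        exact Ideal.mul_mem_left _ _ (Ideal.subset_span ⟨_, ⟨p, hp, hp0, rfl⟩, rfl⟩)
    obtain ⟨β, ⟨p, hp, hp0, rfl⟩, hβ⟩ := mem_ideal_span_monomial_image.1 (hle h) α (by simp)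
    refine ⟨monomial (α - (grevlex n).degree p) 1 * p, J.mul_mem_left _ hp, ?_, ?_⟩
    · exact mul_ne_zero (by simp) hp0
    · classical
      rw [MonomialOrder.degree_mul (by simp) hp0, MonomialOrder.degree_monomial,
        if_neg one_ne_zero, tsub_add_cancel_of_le hβ]
  · rintro ⟨p, hp, hp0, rfl⟩
    have h1 : (grevlex n).leadingTerm p ∈ initialIdeal J := Ideal.subset_span ⟨p, hp, rfl⟩
    have hc := (grevlex n).leadingCoeff_ne_zero_iff.2 hp0
    have h2 := (initialIdeal J).mul_mem_left (C ((grevlex n).leadingCoeff p)⁻¹) h1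
    rwa [MonomialOrder.leadingTerm, C_mul_monomial, inv_mul_cancel₀ hc] at h2

theorem standardSet_of_le {J : Ideal (MvPolynomial (Fin n) K)} {α β : Fin n →₀ ℕ}
    (hβ : β ∈ standardSet J) (h : α ≤ β) : α ∈ standardSet J := by
  intro hα
  apply hβ
  rw [← tsub_add_cancel_of_le h, ← one_mul (1 : K), ← monomial_mul]
  exact Ideal.mul_mem_left _ _ hα

/-- Macaulay's theorem: the standard monomials form a basis of the quotient. -/
theorem isCompl_standardSet (J : Ideal (MvPolynomial (Fin n) K)) :
    IsCompl (restrictSupport K (standardSet J)) (J.restrictScalars K) := by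
  refine ⟨Submodule.disjoint_def.2 fun u hu huJ => ?_, codisjoint_iff.2 (top_le_iff.1 ?_)⟩
  · by_contra hu0
    exact hu ((grevlex n).degree_mem_support hu0)
      ((monomial_mem_initialIdeal_iff J _).2 ⟨u, huJ, hu0, rfl⟩)
  · have key : ∀ α : Fin n →₀ ℕ, monomial α (1 : K) ∈
        restrictSupport K (standardSet J) ⊔ J.restrictScalars K := by
      intro α
      induction α using (InvImage.wf (grevlex n).toSyn wellFounded_lt).induction with
      | _ α ih =>
        by_cases hα : α ∈ standardSet J
        · exact Submodule.mem_sup_left ((monomial_mem_restrictSupport K).2 (Or.inl hα))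
        · obtain ⟨p, hp, hp0, rfl⟩ := (monomial_mem_initialIdeal_iff J α).1 (not_not.1 hα)
          have h1 : p ∈ restrictSupport K (standardSet J) ⊔ J.restrictScalars K :=
            Submodule.mem_sup_right hp
          -- All other terms of `p` are smaller in the order and are covered by induction, so the
          -- leading term can be solved for.
          rw [p.as_sum, ← Finset.add_sum_erase _ _ ((grevlex n).degree_mem_support hp0)] at h1
          have h2 := (Submodule.add_mem_iff_left _ (Submodule.sum_mem _ fun β hβ => ?_)).1 h1
          · rwa [monomial_eq_smul, Submodule.smul_mem_iff _
              ((grevlex n).coeff_degree_ne_zero_iff.2 hp0)] at h2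
          · rw [monomial_eq_smul]
            refine Submodule.smul_mem _ _ (ih β ?_)
            refine lt_of_le_of_ne ((grevlex n).le_degree (Finset.mem_of_mem_erase hβ)) ?_
            exact fun h => Finset.ne_of_mem_erase hβ ((grevlex n).toSyn.injective h)
    intro p _
    rw [p.as_sum]
    refine Submodule.sum_mem _ fun α _ => ?_
    rw [monomial_eq_smul]
    exact Submodule.smul_mem _ _ (key α)

theorem finrank_gradedPiece_eq_ncard_standardMonomials {J : Ideal (MvPolynomial (Fin n) K)}
    (hJ : ∀ m, ∀ u ∈ J, homogeneousComponent m u ∈ J) (j : ℕ) :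
    Module.finrank K (gradedPiece J j) = (standardMonomials J j).ncard := by
  rw [standardMonomials_eq, finrank_gradedPiece_eq_ncard hJ (isCompl_standardSet J)]

theorem finite_standardMonomials (J : Ideal (MvPolynomial (Fin n) K)) (j : ℕ) :
    (standardMonomials J j).Finite :=
  (Finsupp.finite_of_degree_eq (σ := Fin n) j).subset fun _ h => h.1

end Initial

/-! ### Last exponents and the smallest standard monomials -/

section ReverseLex

variable {K : Type*} [Field K] {n : ℕ}

theorem grevlex_lt_of_last_lt {α β : Fin (n + 1) →₀ ℕ} (h : α.degree = β.degree)
    (hl : β (Fin.last n) < α (Fin.last n)) : α ≺[grevlex (n + 1)] β :=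
  grevlex_lt_iff.2 (Or.inr ⟨h, Fin.last n, hl, fun j hj => absurd hj (Fin.le_last j).not_gt⟩)

theorem last_le_of_grevlex_le {α β : Fin (n + 1) →₀ ℕ} (h : α.degree = β.degree)
    (hle : α ≼[grevlex (n + 1)] β) : β (Fin.last n) ≤ α (Fin.last n) := by
  by_contra! hl
  exact (grevlex_lt_of_last_lt h.symm hl).not_ge hle

/-- If multiplication by `x_n^r` is injective in degree `j`, then it maps standard monomials of
degree `j` to standard monomials. -/
theorem add_single_mem_standardMonomials {J : Ideal (MvPolynomial (Fin (n + 1)) K)}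
    (hJ : ∀ m, ∀ u ∈ J, homogeneousComponent m u ∈ J) {j r : ℕ}
    (hinj : Function.Injective
      (mulMap J (isHomogeneous_linear_pow (isHomogeneous_X K (Fin.last n)) r) j))
    {α : Fin (n + 1) →₀ ℕ} (hα : α ∈ standardMonomials J j) :
    Finsupp.single (Fin.last n) r + α ∈ standardMonomials J (j + r) := by
  classical
  rw [injective_mulMap_iff] at hinj
  have hdeg : (Finsupp.single (Fin.last n) r + α).degree = j + r := by
    rw [map_add, Finsupp.degree_single, hα.1, add_comm]
  refine ⟨hdeg, fun hin => hα.2 ?_⟩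
  obtain ⟨p, hp, hp0, hpα⟩ := (monomial_mem_initialIdeal_iff J _).1 hin
  set p' := homogeneousComponent (j + r) p with hp'
  have hp'h : p'.IsHomogeneous (j + r) := homogeneousComponent_isHomogeneous _ _
  have hle : ∀ β ∈ p'.support, β ≼[grevlex (n + 1)] (Finsupp.single (Fin.last n) r + α) := by
    intro β hβ
    rw [← hpα]
    refine (grevlex (n + 1)).le_degree ?_
    rw [mem_support_iff, hp', coeff_homogeneousComponent] at hβ
    exact mem_support_iff.2 fun h => hβ (by rw [h, ite_self])
  have hc : coeff (Finsupp.single (Fin.last n) r + α) p' ≠ 0 := by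
    rw [hp', coeff_homogeneousComponent, if_pos hdeg, ← hpα]
    exact (grevlex (n + 1)).coeff_degree_ne_zero_iff.2 hp0
  have hdegp := degree_eq_of_forall_le hc hle
  -- Every monomial of `p'` is at most the leading one, so its last exponent is at least `r`.
  obtain ⟨q, hq, hqp⟩ := exists_eq_X_pow_mul (i := Fin.last n) hp'h fun β hβ => by
    have h1 := last_le_of_grevlex_le ((degree_eq_of_mem_support hp'h hβ).trans hdeg.symm)
      (hle β hβ)
    rw [Finsupp.add_apply, Finsupp.single_eq_same] at h1
    omega
  have hp'0 : p' ≠ 0 := fun h => hc (by rw [h, coeff_zero])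
  have hq0 : q ≠ 0 := fun h => hp'0 (by rw [hqp, h, mul_zero])
  refine (monomial_mem_initialIdeal_iff J α).2 ⟨q, hinj q hq (hqp ▸ hJ _ p hp), hq0, ?_⟩
  rw [hqp, X_pow_eq_monomial, MonomialOrder.degree_mul (by simp) hq0,
    MonomialOrder.degree_monomial, if_neg one_ne_zero] at hdegp
  exact add_left_cancel hdegp

/-- If multiplication by `x_n^r` is surjective from degree `j`, then all standard monomials of
degree `j + r` are divisible by `x_n^r`. -/
theorem le_last_of_mem_standardMonomials {J : Ideal (MvPolynomial (Fin (n + 1)) K)} {j r : ℕ}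
    (hsurj : Function.Surjective
      (mulMap J (isHomogeneous_linear_pow (isHomogeneous_X K (Fin.last n)) r) j))
    {β : Fin (n + 1) →₀ ℕ} (hβ : β ∈ standardMonomials J (j + r)) : r ≤ β (Fin.last n) := by
  classical
  rw [surjective_mulMap_iff] at hsurj
  by_contra! hlt
  have hmon := isHomogeneous_monomial (1 : K) hβ.1
  obtain ⟨q, hq, hqJ⟩ := hsurj (monomial β 1) hmon
  set p := monomial β (1 : K) - X (Fin.last n) ^ r * q with hp
  have hph : p.IsHomogeneous (j + r) := by
    refine hmon.sub ?_
    rw [add_comm j r]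
    exact (isHomogeneous_X_pow _ _).mul hq
  have hcoeff : ∀ γ : Fin (n + 1) →₀ ℕ, γ (Fin.last n) < r →
      coeff γ (X (Fin.last n) ^ r * q) = 0 := by
    intro γ hγ
    rw [X_pow_eq_monomial, coeff_monomial_mul', if_neg]
    rw [Finsupp.single_le_iff]
    omega
  have hc : coeff β p ≠ 0 := by
    rw [hp, coeff_sub, hcoeff β hlt, coeff_monomial, if_pos rfl, sub_zero]
    exact one_ne_zero
  refine hβ.2 ((monomial_mem_initialIdeal_iff J β).2 ⟨p, hqJ, fun h => hc (by rw [h, coeff_zero]),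
    degree_eq_of_forall_le hc fun γ hγ => ?_⟩)
  -- Any other monomial of `p` comes from `x_n^r q`, so its last exponent is at least `r` and
  -- exceeds that of `β`; thus `β` is leading.
  by_cases hγβ : γ = β
  · rw [hγβ]
  · refine (grevlex_lt_of_last_lt ((degree_eq_of_mem_support hph hγ).trans hβ.1.symm) ?_).le
    by_contra! hle
    refine mem_support_iff.1 hγ ?_
    rw [hp, coeff_sub, hcoeff γ (by omega), coeff_monomial, if_neg (Ne.symm hγβ), sub_zero]

theorem sub_single_mem_standardMonomials {J : Ideal (MvPolynomial (Fin (n + 1)) K)} {j r : ℕ}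
    {β : Fin (n + 1) →₀ ℕ} (hβ : β ∈ standardMonomials J (j + r)) (hr : r ≤ β (Fin.last n)) :
    β - Finsupp.single (Fin.last n) r ∈ standardMonomials J j := by
  refine ⟨?_, standardSet_of_le hβ.2 tsub_le_self⟩
  have h1 := congrArg Finsupp.degree (tsub_add_cancel_of_le (Finsupp.single_le_iff.2 hr))
  rw [map_add, Finsupp.degree_single, hβ.1] at h1
  exact Nat.add_right_cancel h1

/-- If `x_n^r` is injective in degree `j`, then `x_n^r B_j` consists of the smallest monomials of
`B_{j+r}`. -/
theorem isSmallest_varPowMul {J : Ideal (MvPolynomial (Fin (n + 1)) K)}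
    (hJ : ∀ m, ∀ u ∈ J, homogeneousComponent m u ∈ J) {j r : ℕ}
    (hinj : Function.Injective
      (mulMap J (isHomogeneous_linear_pow (isHomogeneous_X K (Fin.last n)) r) j)) :
    IsSmallest (standardMonomials J j).ncard (standardMonomials J (j + r))
      (varPowMul (Fin.last n) r (standardMonomials J j)) := by
  refine ⟨?_, (finite_standardMonomials J j).image _,
    Set.ncard_image_of_injective _ (add_right_injective _), ?_⟩
  · rintro _ ⟨α, hα, rfl⟩
    exact add_single_mem_standardMonomials hJ hinj hα
  · rintro _ ⟨α, hα, rfl⟩ β ⟨hβ, hβ'⟩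
    refine grevlex_lt_of_last_lt ?_ ?_
    · simp only
      rw [map_add, Finsupp.degree_single, hα.1, hβ.1, add_comm]
    · rw [Finsupp.add_apply, Finsupp.single_eq_same]
      by_contra! hle
      -- A standard monomial divisible by `x_n^r` would have a standard quotient, so those outside
      -- the image have last exponent below `r`.
      exact hβ' ⟨_, sub_single_mem_standardMonomials hβ (by omega),
        add_tsub_cancel_of_le (Finsupp.single_le_iff.2 (by omega))⟩

/-- If all powers of `x_n` are injective below and surjective above the middle degree and `x_n^r`
is surjective from degree `j`, then `B_{j+r} = x_n^r S` where `S` consists of the smallest monomials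
of `B_j`. -/
theorem exists_isSmallest_eq_varPowMul {J : Ideal (MvPolynomial (Fin (n + 1)) K)} {δ : ℕ}
    (hJ : ∀ m, ∀ u ∈ J, homogeneousComponent m u ∈ J)
    (hinj : ∀ i r, 2 * i + r ≤ δ → Function.Injective
      (mulMap J (isHomogeneous_linear_pow (isHomogeneous_X K (Fin.last n)) r) i))
    (hsurj : ∀ i r, δ ≤ 2 * i + r → Function.Surjective
      (mulMap J (isHomogeneous_linear_pow (isHomogeneous_X K (Fin.last n)) r) i))
    (hlarge : ∀ m, δ < m → standardMonomials J m = ∅) {j r : ℕ}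
    (hjr : Function.Surjective
      (mulMap J (isHomogeneous_linear_pow (isHomogeneous_X K (Fin.last n)) r) j)) :
    ∃ S : Set (Fin (n + 1) →₀ ℕ),
      IsSmallest (standardMonomials J (j + r)).ncard (standardMonomials J j) S ∧
      standardMonomials J (j + r) = varPowMul (Fin.last n) r S := by
  set S := {α ∈ standardMonomials J j |
    Finsupp.single (Fin.last n) r + α ∈ standardMonomials J (j + r)} with hS
  have heq : standardMonomials J (j + r) = varPowMul (Fin.last n) r S := by
    refine Set.Subset.antisymm (fun β hβ => ?_) ?_
    · have hr := le_last_of_mem_standardMonomials hjr hβ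
      have h1 : Finsupp.single (Fin.last n) r + (β - Finsupp.single (Fin.last n) r) = β :=
        add_tsub_cancel_of_le (Finsupp.single_le_iff.2 hr)
      exact ⟨_, ⟨sub_single_mem_standardMonomials hβ hr, h1.symm ▸ hβ⟩, h1⟩
    · rintro _ ⟨α, hα, rfl⟩
      exact hα.2
  refine ⟨S, ⟨Set.sep_subset _ _, (finite_standardMonomials J j).subset (Set.sep_subset _ _),
    ?_, ?_⟩, heq⟩
  · rw [heq]
    exact (Set.ncard_image_of_injective _ (add_right_injective _)).symm
  · rintro v ⟨hv, hvr⟩ u ⟨hu, huS⟩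
    have hur : Finsupp.single (Fin.last n) r + u ∉ standardMonomials J (j + r) :=
      fun h => huS ⟨hu, h⟩
    refine grevlex_lt_of_last_lt (hv.1.trans hu.1.symm) ?_
    -- Suppose `v_n = b ≤ u_n` and put `i = j - b`. Then `u / x_n^b` is standard of degree `i`, so
    -- injectivity of `x_n^(b+r)` there would make `x_n^r u` standard; hence `2i + b + r > δ`.
    by_contra! hle
    set b := v (Fin.last n) with hb
    have hbj : b ≤ j := hv.1 ▸ Finsupp.le_degree (Fin.last n) v
    obtain ⟨i, rfl⟩ := Nat.exists_eq_add_of_le' hbj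
    have h1 : δ < 2 * i + (b + r) := by
      by_contra! h
      have h2 := add_single_mem_standardMonomials hJ (hinj i (b + r) h)
        (sub_single_mem_standardMonomials hu hle)
      rw [add_comm b r, Finsupp.single_add, add_assoc,
        add_tsub_cancel_of_le (Finsupp.single_le_iff.2 hle), add_comm r b, ← add_assoc] at h2
      exact hur h2
    rcases Nat.eq_zero_or_pos i with rfl | hi
    · rw [hlarge _ (by omega)] at hvr
      exact hvr
    -- Now `2(i-1) + (b+r+1) ≥ δ`, so surjectivity from degree `i - 1` makes `x_n^r v` divisible by
    -- `x_n^(b+r+1)`, although its last exponent is `b + r`.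
    · have h3 := le_last_of_mem_standardMonomials (hsurj (i - 1) (b + r + 1) (by omega))
        (β := Finsupp.single (Fin.last n) r + v)
        (by convert hvr using 2; omega)
      rw [Finsupp.add_apply, Finsupp.single_eq_same] at h3
      omega

end ReverseLex

/-! ### Assembly, including forms of degree zero -/

section Main

variable {F K : Type*} [Field F] [Field K] [Algebra F K] {n : ℕ}

/-- A form of degree zero is a constant, and algebraic independence makes that constant nonzero. -/
theorem eq_top_of_generic_of_degree_eq_zero {s : ℕ} {d : Fin s → ℕ}
    {f : Fin s → MvPolynomial (Fin n) K} (hf : ∀ i, (f i).IsHomogeneous (d i))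
    (hind : AlgebraicIndependent F
      (fun p : (i : Fin s) × {a : Fin n →₀ ℕ // a.degree = d i} => (f p.1).coeff p.2.1))
    {i : Fin s} (hi : d i = 0) : Ideal.span (Set.range f) = ⊤ := by
  have h0 : coeff 0 (f i) ≠ 0 := hind.ne_zero ⟨i, 0, by rw [hi, map_zero]⟩
  have hC : f i = C (coeff 0 (f i)) := by
    rw [← homogeneousComponent_zero, homogeneousComponent_eq_self (hi ▸ hf i)]
  refine Ideal.eq_top_of_isUnit_mem _ (Ideal.subset_span ⟨i, rfl⟩) ?_
  rw [hC]
  exact (isUnit_iff_ne_zero.2 h0).map C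

/-- The strong Lefschetz property of a generic ideal, relative to a middle degree `δ / 2`. -/
theorem exists_socle_of_isGenericIdeal {d : Fin (n + 1) → ℕ}
    {J : Ideal (MvPolynomial (Fin (n + 1)) K)} (hgen : IsGenericIdeal F d J) :
    (∀ m, ∀ u ∈ J, homogeneousComponent m u ∈ J) ∧
      Module.Finite K (MvPolynomial (Fin (n + 1)) K ⧸ J) ∧ ∃ δ : ℕ,
        (∀ m, δ < m → standardMonomials J m = ∅) ∧ ∀ i r : ℕ,
          (2 * i + r ≤ δ → Function.Injective
            (mulMap J (isHomogeneous_linear_pow (isHomogeneous_X K (Fin.last n)) r) i)) ∧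
          (δ ≤ 2 * i + r → Function.Surjective
            (mulMap J (isHomogeneous_linear_pow (isHomogeneous_X K (Fin.last n)) r) i)) := by
  obtain ⟨f, hf, hind, rfl⟩ := hgen
  have hJ : ∀ m, ∀ u ∈ Ideal.span (Set.range f),
    homogeneousComponent m u ∈ Ideal.span (Set.range f) :=
    fun m u hu => homogeneousComponent_mem_span hf m hu
  refine ⟨hJ, ?_⟩
  by_cases hd : ∀ i, d i ≠ 0
  · have hbox := isCompl_box_of_generic hd hf hind
    refine ⟨finite_quotient_of_isCompl_box hbox, ∑ i, (d i - 1), fun m hm => ?_,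
      lefschetz_of_generic hd hf hind⟩
    rw [← Set.ncard_eq_zero (finite_standardMonomials _ m),
      ← finrank_gradedPiece_eq_ncard_standardMonomials hJ, finrank_gradedPiece_eq_ncard hJ hbox,
      show {α ∈ box d | α.degree = m} = ∅ from Set.eq_empty_of_forall_notMem fun α hα => by
        have := box_degree_le hα.1
        have := hα.2
        omega, Set.ncard_empty]
  · push Not at hd
    obtain ⟨i, hi⟩ := hd
    rw [eq_top_of_generic_of_degree_eq_zero hf hind hi]
    have hsub : Subsingleton (MvPolynomial (Fin (n + 1)) K ⧸
        (⊤ : Ideal (MvPolynomial (Fin (n + 1)) K))) :=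
      Ideal.Quotient.subsingleton_iff.2 rfl
    -- Since the quotient is zero, 0 is an arbitrary choice of middle parameter.
    refine ⟨inferInstance, 0, fun m _ => Set.eq_empty_of_forall_notMem fun α hα => ?_,
      fun i r => ⟨fun _ => Function.injective_of_subsingleton _,
        fun _ => Function.surjective_to_subsingleton _⟩⟩
    exact hα.2 ((monomial_mem_initialIdeal_iff _ α).2 ⟨monomial α 1, trivial, by simp, by
      classical rw [MonomialOrder.degree_monomial, if_neg one_ne_zero]⟩)

end Main

end GenericIdeal

theorem mainTheorem7 {F K : Type*} [Field F] [Field K] [Algebra F K] (n : ℕ)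
    (d : Fin (n + 1) → ℕ) (J : Ideal (MvPolynomial (Fin (n + 1)) K))
    (hJ : GenericIdeal.IsGenericIdeal F d J) :
    (∀ j r : ℕ, (j : ℤ) ≤ (∑ i, (d i : ℤ)) - (n + 1) →
      (Function.Injective (GenericIdeal.mulMap J
          (GenericIdeal.isHomogeneous_linear_pow
            (MvPolynomial.isHomogeneous_X K (Fin.last n)) r) j) ∨
        Function.Surjective (GenericIdeal.mulMap J
          (GenericIdeal.isHomogeneous_linear_pow
            (MvPolynomial.isHomogeneous_X K (Fin.last n)) r) j)) ∧
      ((GenericIdeal.standardMonomials J j).ncard ≤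
          (GenericIdeal.standardMonomials J (j + r)).ncard →
        GenericIdeal.IsSmallest (GenericIdeal.standardMonomials J j).ncard
          (GenericIdeal.standardMonomials J (j + r))
          (GenericIdeal.varPowMul (Fin.last n) r (GenericIdeal.standardMonomials J j))) ∧
      ((GenericIdeal.standardMonomials J (j + r)).ncard ≤
          (GenericIdeal.standardMonomials J j).ncard →
        ∃ S : Set (Fin (n + 1) →₀ ℕ),
          GenericIdeal.IsSmallest (GenericIdeal.standardMonomials J (j + r)).ncard
            (GenericIdeal.standardMonomials J j) S ∧
          GenericIdeal.standardMonomials J (j + r) =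
            GenericIdeal.varPowMul (Fin.last n) r S)) ∧
    GenericIdeal.IsStrongLefschetzElement J (MvPolynomial.X (Fin.last n)) := by
  obtain ⟨hhom, hfin, δ, hlarge, hlef⟩ := GenericIdeal.exists_socle_of_isGenericIdeal hJ
  have hor : ∀ j r : ℕ,
      Function.Injective (GenericIdeal.mulMap J (GenericIdeal.isHomogeneous_linear_pow
        (MvPolynomial.isHomogeneous_X K (Fin.last n)) r) j) ∨
      Function.Surjective (GenericIdeal.mulMap J (GenericIdeal.isHomogeneous_linear_pow
        (MvPolynomial.isHomogeneous_X K (Fin.last n)) r) j) := fun j r =>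
    (le_total (2 * j + r) δ).imp (hlef j r).1 (hlef j r).2
  have hmax : GenericIdeal.IsStrongLefschetzElement J (MvPolynomial.X (Fin.last n)) := by
    refine ⟨hfin, MvPolynomial.isHomogeneous_X K (Fin.last n), fun i r => ⟨fun hle => ?_,
      fun hle => ?_⟩⟩
    · refine (hor i r).elim id fun hs => ?_
      -- If the other alternative holds, the two dimension inequalities force equality, and the map
      -- is bijective.
      exact (LinearMap.injective_iff_surjective_of_finrank_eq_finrank
        (le_antisymm hle (LinearMap.finrank_le_finrank_of_surjective hs))).2 hs
    · refine (hor i r).elim (fun hi => ?_) id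
      exact (LinearMap.injective_iff_surjective_of_finrank_eq_finrank
        (le_antisymm (LinearMap.finrank_le_finrank_of_injective hi) hle)).1 hi
  have hmaps := hmax.2.choose_spec
  refine ⟨fun j r _ => ⟨hor j r, fun hle => ?_, fun hle => ?_⟩, hmax⟩
  · rw [← GenericIdeal.finrank_gradedPiece_eq_ncard_standardMonomials hhom,
      ← GenericIdeal.finrank_gradedPiece_eq_ncard_standardMonomials hhom] at hle
    exact GenericIdeal.isSmallest_varPowMul hhom ((hmaps j r).1 hle)
  · rw [← GenericIdeal.finrank_gradedPiece_eq_ncard_standardMonomials hhom,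
      ← GenericIdeal.finrank_gradedPiece_eq_ncard_standardMonomials hhom] at hle
    exact GenericIdeal.exists_isSmallest_eq_varPowMul hhom (fun i r => (hlef i r).1)
      (fun i r => (hlef i r).2) hlarge ((hmaps j r).2 hle)
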